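/- Rings are commutative and unital. Let $\mathcal S$ be a monoid and let $R$ be an $\mathcal S$-ring, i.e. a ring with a monoid morphism $s\mapsto\varphi_s$ from $\mathcal S$ to the ring endomorphisms of $R$. Let $r\in R$ be such that $(R,r)$ is an $\mathcal S$-dévissage setup: $R$ is $r$-torsion-free, $r$-adically complete and separated, and $\varphi_s(r)R=rR$ for all $s\in\mathcal S$. An $\mathcal S$-module over $R$ is an $R$-module $D$ with a monoid morphism $s\mapsto\varphi_{s,D}$ from $\mathcal S$ to the additive endomorphisms of $D$ such that $\varphi_{s,D}(ad)=\varphi_s(a)\varphi_{s,D}(d)$ for all $s\in\mathcal S$, $a\in R$, $d\in D$; morphisms are the $R$-linear maps commuting with all $\varphi_s$. These form a symmetric monoidal category with unit $R$ (with action $\varphi_s$), tensor product $D_1\otimes_R D_2$ with $\varphi_s(d_1\otimes d_2)=\varphi_{s,D_1}(d_1)\otimes\varphi_{s,D_2}(d_2)$, and the associativity, unit and swap isomorphisms of $R$-modules. The $\mathcal S$-module $D$ is étale if it is finitely presented over $R$ and, for every $s\in\mathcal S$, the linearisation $$\varphi_{s,D}^*\colon\ \varphi_s^*D=R\otimes_{\varphi_s,R}D\to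 D,\qquad a\otimes d\mapsto a\,\varphi_{s,D}(d),$$ is an isomorphism. If $D_1$ is étale and $D_2$ is any $\mathcal S$-module over $R$, the internal Hom $\underline{\mathrm{Hom}}_R(D_1,D_2)$ is the $R$-module $\mathrm{Hom}_R(D_1,D_2)$ on which $s\in\mathcal S$ acts by $f\mapsto\varphi_{s,D_2}^*\circ(\mathrm{id}\otimes f)\circ(\varphi_{s,D_1}^*)^{-1}$. Let $\mathcal C$ be the full subcategory of the étale $\mathcal S$-modules $D$ over $R$ with finite projective $(r,\mu)$-dévissage (for every $n\ge 0$, the $R/r$-module $r^nD/r^{n+1}D$ is finite projective of constant rank) and bounded $r^\infty$-torsion (there is an $N$ such that $r^N$ kills every element of $D$ killed by a power of $r$). Then: 1. $\mathcal C$ is closed under the symmetric monoidal structure: $R\in\mathcal C$, and $D_1\otimes_R D_2\in\mathcal C$ for all $D_1,D_2\in\mathcal C$. 2. If $\mathrm K_0(R/r)=\mathbb Z$ (i.e. the canonical map $\mathbb Z\to \mathrm K_0(R/r)$, $n\mapsto n[R/r]$, is an isomorphism, where $\mathrm K_0$ is the Grothendieck group of finite projective modules), then $\underline{\mathrm{Hom}}_R(D_1,D_2)\in\mathcal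 C$ for all $D_1,D_2\in\mathcal C$. -/

import Mathlib

open CategoryTheory MonoidalCategory TensorProduct

universe w u

noncomputable section

namespace Devissage

/-! ### Commutative algebra -/

/-- `M` is a finite projective `A`-module of constant rank. -/
def IsFiniteProjectiveOfConstantRank (A : Type*) (M : Type*) [CommRing A] [AddCommGroup M]
    [Module A M] : Prop :=
  Module.Finite A M ∧ Module.Projective A M ∧
    ∃ d : ℕ, ∀ p : PrimeSpectrum A, Module.rankAtStalk (R := A) M p = d

section

variable {R : Type*} [CommRing R]

/-- The submodule `r ^ n M` of `M`. -/
abbrev powSubmodule (r : R) (M : Type*) [AddCommGroup M] [Module R M] (n : ℕ) : Submodule R M :=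
  Ideal.span {r ^ n} • (⊤ : Submodule R M)

/-- The subquotient `r ^ n M / r ^ (n + 1) M`, written as the quotient of `N = r ^ n M` by `r N`.
It carries Mathlib's structure of a module over `R / r`. -/
abbrev MuSubquotient (r : R) (M : Type*) [AddCommGroup M] [Module R M] (n : ℕ) : Type _ :=
  powSubmodule r M n ⧸ (Ideal.span {r} • ⊤ : Submodule R (powSubmodule r M n))

/-- `M` has finite projective `(r, μ)`-dévissage. -/
def HasFiniteProjectiveMuDevissage (r : R) (M : Type*) [AddCommGroup M] [Module R M] : Prop :=
  ∀ n : ℕ, IsFiniteProjectiveOfConstantRank (R ⧸ Ideal.span {r}) (MuSubquotient r M n)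

/-- The `r ^ ∞`-torsion of `M` is bounded: it is killed by a single power of `r`. -/
def HasBoundedTorsion (r : R) (M : Type*) [AddCommGroup M] [Module R M] : Prop :=
  ∃ N : ℕ, ∀ m : M, (∃ n : ℕ, r ^ n • m = 0) → r ^ N • m = 0

end

/-! ### The Grothendieck group `K₀` -/

section K0

/-- Finite projective `A`-modules. -/
abbrev FinProj (A : Type u) [CommRing A] : Type (u + 1) :=
  {P : ModuleCat.{u} A // Module.Finite A P ∧ Module.Projective A P}

/-- Isomorphism of finite projective modules. -/
instance finProjSetoid (A : Type u) [CommRing A] : Setoid (FinProj A) where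
  r P Q := Nonempty (P.1 ≃ₗ[A] Q.1)
  iseqv :=
    { refl := fun P => ⟨LinearEquiv.refl A P.1⟩
      symm := fun ⟨e⟩ => ⟨e.symm⟩
      trans := fun ⟨e⟩ ⟨f⟩ => ⟨e.trans f⟩ }

/-- Isomorphism classes of finite projective `A`-modules. -/
def FinProjClass (A : Type u) [CommRing A] : Type (u + 1) := Quotient (finProjSetoid A)

variable {A : Type u} [CommRing A]

/-- The isomorphism class of a finite projective module. -/
def FinProjClass.mk (P : Type u) [AddCommGroup P] [Module A P] [Module.Finite A P]
    [Module.Projective A P] : FinProjClass A :=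
  Quotient.mk (finProjSetoid A) ⟨ModuleCat.of A P, ‹_›, ‹_›⟩

/-- The direct sum of two finite projective modules. -/
def FinProj.sum (P Q : FinProj A) : FinProj A :=
  haveI := P.2.1
  haveI := P.2.2
  haveI := Q.2.1
  haveI := Q.2.2
  ⟨ModuleCat.of A (P.1 × Q.1), inferInstanceAs (Module.Finite A (P.1 × Q.1)),
    inferInstanceAs (Module.Projective A (P.1 × Q.1))⟩

instance : Add (FinProjClass A) where
  add := Quotient.map₂ FinProj.sum (fun _ _ ⟨e⟩ _ _ ⟨f⟩ => ⟨LinearEquiv.prodCongr e f⟩)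

instance : Zero (FinProjClass A) where
  zero := FinProjClass.mk PUnit.{u + 1}

/-- Isomorphism classes form a commutative monoid under direct sum. -/
instance : AddCommMonoid (FinProjClass A) where
  add_assoc := by
    rintro ⟨P⟩ ⟨Q⟩ ⟨T⟩
    exact Quotient.sound ⟨LinearEquiv.prodAssoc A P.1 Q.1 T.1⟩
  zero_add := by
    rintro ⟨P⟩
    exact Quotient.sound ⟨(LinearEquiv.prodComm A PUnit.{u + 1} P.1).trans
      (LinearEquiv.prodUnique (R := A) (M := P.1) (M₂ := PUnit.{u + 1}))⟩
  add_zero := by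
    rintro ⟨P⟩
    exact Quotient.sound ⟨LinearEquiv.prodUnique (R := A) (M := P.1) (M₂ := PUnit.{u + 1})⟩
  add_comm := by
    rintro ⟨P⟩ ⟨Q⟩
    exact Quotient.sound ⟨LinearEquiv.prodComm A P.1 Q.1⟩
  nsmul := nsmulRec

variable (A)

/-- The group `K₀(A)`: the group completion of the monoid of isomorphism classes of finite
projective `A`-modules under direct sum. -/
abbrev K0 : Type (u + 1) := Algebra.GrothendieckAddGroup (FinProjClass A)

/-- The class of the module `A` in `K₀(A)`. -/
def K0.one : K0 A := Algebra.GrothendieckAddGroup.of (FinProjClass.mk (A := A) A)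

/-- `K₀(A) = ℤ`: the canonical map `ℤ → K₀(A)`, `n ↦ n [A]`, is an isomorphism. -/
def K0EqInt : Prop := Function.Bijective (fun n : ℤ => n • K0.one A)

end K0

/-! ### Linearisation -/

section Twist

/-- The ring `R`, to be seen as an `R`-algebra through `φ`. -/
def Twist {R : Type u} [CommRing R] (_φ : R →+* R) : Type u := R

variable {R : Type u} [CommRing R] (φ : R →+* R)

instance : CommRing (Twist φ) := inferInstanceAs (CommRing R)

/-- The structure map `R → Twist φ` is `φ`. -/
instance : Algebra R (Twist φ) := φ.toAlgebra

/-- The identity of the underlying rings `Twist φ = R`. -/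
def Twist.val : Twist φ →+* R := RingHom.id R

variable {φ} {D D' : Type u} [AddCommGroup D] [Module R D] [AddCommGroup D'] [Module R D']

/-- The linearisation `φ^* D = R ⊗_{φ, R} D → D'`, `a ⊗ d ↦ a f(d)`, of a `φ`-semilinear map
`f : D → D'`. The module `φ^* D` is an `R`-module through the left factor `Twist φ = R`. -/
def linearisation (f : D →ₛₗ[φ] D') : Twist φ ⊗[R] D →ₛₗ[Twist.val φ] D' :=
  let g : Twist φ ⊗[R] D →+ D' := TensorProduct.liftAddHom
    { toFun := fun a =>
        { toFun := fun d => Twist.val φ a • f d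
          map_zero' := by simp
          map_add' := by simp }
      map_zero' := by ext; simp
      map_add' := fun a b => by ext; simp [add_smul] }
    (fun r a d => by
      change (φ r * Twist.val φ a) • f d = Twist.val φ a • f (r • d)
      rw [map_smulₛₗ, smul_smul, mul_comm])
  { g with
    map_smul' := fun b x => by
      change g (b • x) = Twist.val φ b • g x
      induction x with
      | zero => simp
      | add x y hx hy => rw [smul_add, map_add, hx, hy, map_add, smul_add]
      | tmul a d =>
        change Twist.val φ (b * a) • f d = Twist.val φ b • (Twist.val φ a • f d)
        rw [map_mul, mul_smul] }

@[simp]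
theorem linearisation_tmul (f : D →ₛₗ[φ] D') (a : Twist φ) (d : D) :
    linearisation f (a ⊗ₜ[R] d) = Twist.val φ a • f d := rfl

end Twist

/-! ### The category of `S`-modules over `R` -/

section

variable (S : Type w) (R : Type u) [Monoid S] [CommRing R] [MulSemiringAction S R]

/-- An `S`-module over the `S`-ring `R`: an `R`-module with a monoid morphism
`s ↦ φ s` to its additive endomorphisms such that each `φ s` is semilinear. -/
structure SModule where
  /-- the underlying module -/
  carrier : Type u
  [addCommGroup : AddCommGroup carrier]
  [module : Module R carrier]
  /-- the action of `S` -/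
  φ : S →* AddMonoid.End carrier
  φ_smul : ∀ (s : S) (a : R) (d : carrier), φ s (a • d) = (s • a) • φ s d

variable {S R}

namespace SModule

instance : CoeSort (SModule S R) (Type u) := ⟨SModule.carrier⟩

attribute [instance] SModule.addCommGroup SModule.module

/-- A morphism of `S`-modules over `R`. -/
@[ext]
structure Hom (D₁ D₂ : SModule S R) where
  /-- the underlying linear map -/
  lin : D₁ →ₗ[R] D₂
  comm : ∀ (s : S) (d : D₁), lin (D₁.φ s d) = D₂.φ s (lin d)

instance : Category (SModule S R) where
  Hom := Hom
  id D := ⟨LinearMap.id, fun _ _ => rfl⟩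
  comp f g := ⟨g.lin ∘ₗ f.lin, fun s d => by simp [f.comm, g.comm]⟩

@[ext]
theorem hom_ext {D₁ D₂ : SModule S R} {f g : D₁ ⟶ D₂} (h : f.lin = g.lin) : f = g :=
  Hom.ext h

/-- The forgetful functor to `R`-modules. -/
def forgetToModuleCat : SModule S R ⥤ ModuleCat.{u} R where
  obj D := ModuleCat.of R D
  map f := ModuleCat.ofHom f.lin

instance : (forgetToModuleCat (S := S) (R := R)).Faithful where
  map_injective h := hom_ext (congrArg ModuleCat.Hom.hom h)

/-- The action of `s` as a semilinear map. -/
def semilinear (D : SModule S R) (s : S) : D →ₛₗ[MulSemiringAction.toRingHom S R s] D where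
  toFun := D.φ s
  map_add' := map_add _
  map_smul' := D.φ_smul s

@[simp]
theorem semilinear_apply (D : SModule S R) (s : S) (d : D) : D.semilinear s d = D.φ s d := rfl

/-- The linearisation `φ_s^* D → D`, `a ⊗ d ↦ a φ_s(d)`, of the action of `s`. -/
def linearised (D : SModule S R) (s : S) :
    Twist (MulSemiringAction.toRingHom S R s) ⊗[R] D
      →ₛₗ[Twist.val (MulSemiringAction.toRingHom S R s)] D :=
  linearisation (D.semilinear s)

/-- Étale `S`-modules over `R`: the underlying module is finitely presented and the
linearisations `φ_s^* D → D` are isomorphisms. -/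
structure IsEtale (D : SModule S R) : Prop where
  finitePresentation : Module.FinitePresentation R D
  bijective : ∀ s : S, Function.Bijective (D.linearised s)

/-! #### Symmetric monoidal structure -/

/-- The semilinear endomorphism `φ s ⊗ φ s` of `D₁ ⊗ D₂`. -/
def tensorSemilinear (D₁ D₂ : SModule S R) (s : S) :
    D₁ ⊗[R] D₂ →ₛₗ[MulSemiringAction.toRingHom S R s] D₁ ⊗[R] D₂ :=
  TensorProduct.map (D₁.semilinear s) (D₂.semilinear s)

theorem tensorSemilinear_tmul (D₁ D₂ : SModule S R) (s : S) (a : D₁) (b : D₂) :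
    tensorSemilinear D₁ D₂ s (a ⊗ₜ[R] b) = D₁.φ s a ⊗ₜ[R] D₂.φ s b := rfl

/-- The tensor product over `R`, with `φ s (d₁ ⊗ d₂) = φ s d₁ ⊗ φ s d₂`. -/
def tensor (D₁ D₂ : SModule S R) : SModule S R where
  carrier := D₁ ⊗[R] D₂
  φ :=
    { toFun := fun s => (tensorSemilinear D₁ D₂ s).toAddMonoidHom
      map_one' := by
        ext x
        change tensorSemilinear D₁ D₂ 1 x = x
        induction x with
        | zero => simp
        | add x y hx hy => rw [map_add, hx, hy]
        | tmul a b => simp [tensorSemilinear_tmul]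
      map_mul' := fun s t => by
        ext x
        change tensorSemilinear D₁ D₂ (s * t) x =
          tensorSemilinear D₁ D₂ s (tensorSemilinear D₁ D₂ t x)
        induction x with
        | zero => simp
        | add x y hx hy => rw [map_add, hx, hy, map_add, map_add]
        | tmul a b => simp [tensorSemilinear_tmul] }
  φ_smul s a x := (tensorSemilinear D₁ D₂ s).map_smulₛₗ a x

/-- The `S`-module `R`, on which `S` acts through its action on the ring `R`. -/
def unit (S : Type w) (R : Type u) [Monoid S] [CommRing R] [MulSemiringAction S R] :
    SModule S R where
  carrier := R
  φ :=
    { toFun := fun s => (MulSemiringAction.toRingHom S R s).toAddMonoidHom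
      map_one' := by ext x; exact one_smul S x
      map_mul' := fun s t => by ext x; exact mul_smul s t x }
  φ_smul s a x := smul_mul' s a x

/-- Equivariance of a linear map out of a tensor product can be tested on pure tensors. -/
theorem equivariant_of_tmul {D₁ D₂ X : SModule S R} (g : D₁ ⊗[R] D₂ →ₗ[R] X)
    (h : ∀ (s : S) (a : D₁) (b : D₂),
      g (D₁.φ s a ⊗ₜ[R] D₂.φ s b) = X.φ s (g (a ⊗ₜ[R] b)))
    (s : S) (x : D₁ ⊗[R] D₂) : g (tensorSemilinear D₁ D₂ s x) = X.φ s (g x) := by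
  induction x with
  | zero => simp
  | add x y hx hy => simp only [map_add, hx, hy]
  | tmul a b => exact h s a b

/-- An equivariant linear equivalence is an isomorphism of `S`-modules. -/
def isoMk {D₁ D₂ : SModule S R} (e : D₁ ≃ₗ[R] D₂) (h : ∀ s d, e (D₁.φ s d) = D₂.φ s (e d)) :
    D₁ ≅ D₂ where
  hom := ⟨e.toLinearMap, h⟩
  inv := ⟨e.symm.toLinearMap, fun s d => e.injective (by
    simp only [LinearEquiv.coe_coe, h, LinearEquiv.apply_symm_apply])⟩
  hom_inv_id := hom_ext (by ext x; exact e.symm_apply_apply x)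
  inv_hom_id := hom_ext (by ext x; exact e.apply_symm_apply x)

/-- The tensor product of two morphisms. -/
def tensorMap {D₁ D₂ E₁ E₂ : SModule S R} (f : D₁ ⟶ D₂) (g : E₁ ⟶ E₂) :
    tensor D₁ E₁ ⟶ tensor D₂ E₂ :=
  ⟨TensorProduct.map f.lin g.lin,
    equivariant_of_tmul (X := tensor D₂ E₂) (TensorProduct.map f.lin g.lin) fun s a b => by
      change f.lin (D₁.φ s a) ⊗ₜ[R] g.lin (E₁.φ s b) = D₂.φ s (f.lin a) ⊗ₜ[R] E₂.φ s (g.lin b)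
      rw [f.comm, g.comm]⟩

/-- The associativity isomorphism of `R`-modules, which is equivariant. -/
def assoc (D₁ D₂ D₃ : SModule S R) :
    tensor (tensor D₁ D₂) D₃ ≅ tensor D₁ (tensor D₂ D₃) :=
  isoMk (TensorProduct.assoc R D₁ D₂ D₃)
    (equivariant_of_tmul (D₁ := tensor D₁ D₂) (X := tensor D₁ (tensor D₂ D₃))
      (TensorProduct.assoc R D₁ D₂ D₃).toLinearMap fun s (a : D₁ ⊗[R] D₂) c => by
        change TensorProduct.assoc R D₁ D₂ D₃ (tensorSemilinear D₁ D₂ s a ⊗ₜ[R] D₃.φ s c) =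
          tensorSemilinear D₁ (tensor D₂ D₃) s (TensorProduct.assoc R D₁ D₂ D₃ (a ⊗ₜ[R] c))
        induction a with
        | zero =>
          rw [TensorProduct.zero_tmul, map_zero, TensorProduct.zero_tmul, map_zero]
          exact (map_zero (tensorSemilinear D₁ (tensor D₂ D₃) s)).symm
        | add x y hx hy =>
          rw [TensorProduct.add_tmul, map_add, map_add, TensorProduct.add_tmul, map_add, hx, hy]
          exact (map_add (tensorSemilinear D₁ (tensor D₂ D₃) s) _ _).symm
        | tmul x y => rfl)

/-- The left unit isomorphism of `R`-modules, which is equivariant. -/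
def leftUnit (D : SModule S R) : tensor (unit S R) D ≅ D :=
  isoMk (TensorProduct.lid R D)
    (equivariant_of_tmul (D₁ := unit S R) (X := D) (TensorProduct.lid R D).toLinearMap
      fun s (a : R) d => (D.φ_smul s a d).symm)

/-- The right unit isomorphism of `R`-modules, which is equivariant. -/
def rightUnit (D : SModule S R) : tensor D (unit S R) ≅ D :=
  isoMk (TensorProduct.rid R D)
    (equivariant_of_tmul (D₂ := unit S R) (X := D) (TensorProduct.rid R D).toLinearMap
      fun s d (a : R) => (D.φ_smul s a d).symm)

/-- The swap of the two factors, which is equivariant. -/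
def swap (D₁ D₂ : SModule S R) : tensor D₁ D₂ ≅ tensor D₂ D₁ :=
  isoMk (TensorProduct.comm R D₁ D₂)
    (equivariant_of_tmul (X := tensor D₂ D₁) (TensorProduct.comm R D₁ D₂).toLinearMap
      fun _ _ _ => rfl)

instance : MonoidalCategoryStruct (SModule S R) where
  tensorObj := tensor
  whiskerLeft D _ _ f := tensorMap (𝟙 D) f
  whiskerRight f D := tensorMap f (𝟙 D)
  tensorHom f g := tensorMap f g
  tensorUnit := unit S R
  associator := assoc
  leftUnitor := leftUnit
  rightUnitor := rightUnit

/-- The forgetful functor to `R`-modules preserves all the data of the monoidal structure. -/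
def inducingData : Monoidal.InducingFunctorData (forgetToModuleCat (S := S) (R := R)) where
  μIso _ _ := Iso.refl _
  εIso := Iso.refl _
  whiskerLeft_eq _ _ _ _ := by ext1; exact TensorProduct.ext rfl
  whiskerRight_eq _ _ := by ext1; exact TensorProduct.ext rfl
  tensorHom_eq _ _ := by ext1; exact TensorProduct.ext rfl
  associator_eq _ _ _ := by ext1; exact TensorProduct.ext (TensorProduct.ext rfl)
  leftUnitor_eq _ := by ext1; exact TensorProduct.ext rfl
  rightUnitor_eq _ := by ext1; exact TensorProduct.ext rfl

/-- `S`-modules over `R` form a monoidal category. -/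
instance : MonoidalCategory (SModule S R) := Monoidal.induced forgetToModuleCat inducingData

/-- The monoidal category of `S`-modules over `R` is symmetric. -/
instance : SymmetricCategory (SModule S R) where
  braiding := swap
  braiding_naturality_right _ _ _ _ := hom_ext (TensorProduct.ext rfl)
  braiding_naturality_left _ _ := hom_ext (TensorProduct.ext rfl)
  hexagon_forward _ _ _ := hom_ext (TensorProduct.ext (TensorProduct.ext rfl))
  hexagon_reverse _ _ _ := hom_ext (TensorProduct.ext (LinearMap.ext fun _ =>
    TensorProduct.ext rfl))
  symmetry _ _ := hom_ext (TensorProduct.ext rfl)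

/-! #### Internal Hom -/

/-- The inverse `D → φ_s^* D` of the linearisation for an étale `D`. -/
def IsEtale.inv {D : SModule S R} (h : D.IsEtale) (s : S) :
    D → Twist (MulSemiringAction.toRingHom S R s) ⊗[R] D :=
  (Equiv.ofBijective (D.linearised s) (h.bijective s)).symm

theorem IsEtale.linearised_inv {D : SModule S R} (h : D.IsEtale) (s : S) (d : D) :
    D.linearised s (h.inv s d) = d :=
  (Equiv.ofBijective (D.linearised s) (h.bijective s)).apply_symm_apply d

theorem IsEtale.inv_linearised {D : SModule S R} (h : D.IsEtale) (s : S)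
    (x : Twist (MulSemiringAction.toRingHom S R s) ⊗[R] D) :
    h.inv s (D.linearised s x) = x :=
  (Equiv.ofBijective (D.linearised s) (h.bijective s)).symm_apply_apply x

/-- The action of `s` on `Hom_R(D₁, D₂)` for an étale `D₁`: it sends `f` to the composite
`D₁ → φ_s^* D₁ → φ_s^* D₂ → D₂` of the inverse of the linearisation of `D₁`, of `id ⊗ f`, and of
the linearisation of `D₂`. -/
def homAction {D₁ : SModule S R} (h : D₁.IsEtale) (D₂ : SModule S R) (s : S)
    (f : D₁ →ₗ[R] D₂) : D₁ →ₗ[R] D₂ where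
  toFun d := D₂.linearised s
    (f.baseChange (Twist (MulSemiringAction.toRingHom S R s)) (h.inv s d))
  map_add' x y := by
    have : h.inv s (x + y) = h.inv s x + h.inv s y := (h.bijective s).1 (by
      rw [map_add, h.linearised_inv, h.linearised_inv, h.linearised_inv])
    rw [this, map_add, map_add]
  map_smul' a x := by
    let b : Twist (MulSemiringAction.toRingHom S R s) := a
    have : h.inv s (a • x) = b • h.inv s x := (h.bijective s).1 (by
      rw [map_smulₛₗ, h.linearised_inv, h.linearised_inv]; rfl)
    rw [this, map_smul, map_smulₛₗ]
    rfl

theorem linearised_one_tmul (D : SModule S R) (s : S) (d : D) :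
    D.linearised s (1 ⊗ₜ[R] d) = D.φ s d := by
  change Twist.val (MulSemiringAction.toRingHom S R s) 1 • D.φ s d = _
  rw [map_one, one_smul]

/-- The action on `Hom_R(D₁, D₂)` is characterised by `(φ s f) (φ s d) = φ s (f d)`. -/
theorem homAction_apply_φ {D₁ : SModule S R} (h : D₁.IsEtale) (D₂ : SModule S R) (s : S)
    (f : D₁ →ₗ[R] D₂) (d : D₁) : homAction h D₂ s f (D₁.φ s d) = D₂.φ s (f d) := by
  change D₂.linearised s (f.baseChange _ (h.inv s (D₁.φ s d))) = _
  rw [← linearised_one_tmul D₁ s d, h.inv_linearised, LinearMap.baseChange_tmul,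
    linearised_one_tmul]

/-- A linear map out of an étale module is determined by its values on the image of `φ s`. -/
theorem IsEtale.hom_eq {D₁ : SModule S R} (h : D₁.IsEtale) {M : Type*} [AddCommGroup M]
    [Module R M] (s : S) {f g : D₁ →ₗ[R] M} (hfg : ∀ d, f (D₁.φ s d) = g (D₁.φ s d)) : f = g := by
  ext d
  rw [← h.linearised_inv s d]
  induction h.inv s d with
  | zero => simp
  | add x y hx hy => rw [map_add, map_add, map_add, hx, hy]
  | tmul a x =>
    change f (Twist.val _ a • D₁.φ s x) = g (Twist.val _ a • D₁.φ s x)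
    rw [map_smul, map_smul, hfg]

/-- The internal Hom: the `R`-module `Hom_R(D₁, D₂)` with the action above. -/
def internalHom (D₁ : SModule S R) (h : D₁.IsEtale) (D₂ : SModule S R) : SModule S R where
  carrier := D₁ →ₗ[R] D₂
  φ :=
    { toFun := fun s =>
        { toFun := homAction h D₂ s
          map_zero' := h.hom_eq s fun d => by simp [homAction_apply_φ]
          map_add' := fun f g => h.hom_eq s fun d => by simp [homAction_apply_φ] }
      map_one' := by
        refine AddMonoidHom.ext fun f => h.hom_eq 1 fun d => ?_
        change homAction h D₂ 1 f _ = f _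
        rw [homAction_apply_φ]
        simp
      map_mul' := fun s t => by
        refine AddMonoidHom.ext fun f => h.hom_eq (s * t) fun d => ?_
        change homAction h D₂ (s * t) f _ = homAction h D₂ s (homAction h D₂ t f) _
        rw [homAction_apply_φ, map_mul, map_mul]
        change _ = homAction h D₂ s (homAction h D₂ t f) (D₁.φ s (D₁.φ t d))
        rw [homAction_apply_φ, homAction_apply_φ]
        rfl }
  φ_smul s a f := h.hom_eq s fun d => by
    change homAction h D₂ s (a • f) _ = (s • a) • homAction h D₂ s f _
    rw [homAction_apply_φ, homAction_apply_φ]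
    exact D₂.φ_smul s a (f d)

end SModule

/-! ### Dévissage setups -/

/-- `(R, r)` is an `S`-dévissage setup: `R` is `r`-torsion-free, `r`-adically complete and
separated, and each `φ_s(r)` generates the ideal `r R`. -/
structure IsDevissageSetup (S : Type w) {R : Type u} [Monoid S] [CommRing R]
    [MulSemiringAction S R] (r : R) : Prop where
  torsionFree : ∀ x : R, r * x = 0 → x = 0
  complete : IsAdicComplete (Ideal.span {r}) R
  span_smul : ∀ s : S, Ideal.span {s • r} = Ideal.span {r}

/-- The étale `S`-modules over `R` with projective `r`-dévissage: étale `S`-modules over `R` with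
finite projective `(r, μ)`-dévissage and bounded `r ^ ∞`-torsion. This is the property of objects
which cuts the full subcategory. -/
structure IsEtaleDevissage (r : R) (D : SModule S R) : Prop where
  etale : D.IsEtale
  devissage : HasFiniteProjectiveMuDevissage r D
  torsion : HasBoundedTorsion r D

/-- The full subcategory of étale `S`-modules over `R` with projective `r`-dévissage. -/
def etaleDevissage (S : Type w) {R : Type u} [Monoid S] [CommRing R] [MulSemiringAction S R]
    (r : R) : ObjectProperty (SModule S R) :=
  fun D => IsEtaleDevissage r D

end

end Devissage

end

/-! The whole argument rests on one structural fact: as an `R`-module, every object of the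
subcategory is a retract of a finite direct sum of cyclic modules `R / t` with `t = 0` or `t = r ^
k` (`IsEtaleDevissage.isCyclicRetract`). If `r ^ N` kills the torsion, then `r ^ N D` is
`r`-torsion-free and projective modulo `r`. By completeness its reduction lifts to a projective
module, and this lift is `r ^ N D` itself. One then climbs from `r ^ (n + 1) D` to `r ^ n D`
(`HasDiagonalPresentation.of_smul`): multiplication by `r` between consecutive subquotients is a
split surjection, its kernel lifts to a projective module mapping into the `r`-torsion, and the old
relations get multiplied by `r`.

For cyclic modules everything is explicit. Tensor products and Hom modules of two of them are again
of the form `R / d`, and the `n`-th subquotient of `R / t` is `0` or `R / r`. Additive functors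
preserve retracts, so tensor and Hom of two objects are finitely presented, have bounded torsion and
have projective subquotients. For tensor products the rank is constant because the subquotients
multiply (`muTensor_injective`); for Hom it is constant because `K₀ = ℤ`.

Étaleness of the tensor product is compatibility of base change with tensor products. For Hom it
amounts to base change along `φ_s` commuting with Hom. No flatness is available, but on cyclic
modules it suffices that `φ_s(r)` is not a zero divisor (`IsCyclicRetract.homBaseChange_bijective`),
and this follows from `φ_s(r) R = r R`. -/

noncomputable section

namespace Devissage

/-! ### Lifting projective modules along `R → R / r` -/

section Lifting

variable {R : Type u} [CommRing R] {r : R}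

theorem mem_span_singleton_smul_top {M : Type*} [AddCommGroup M] [Module R M] {a : R} {m : M} :
    m ∈ (Ideal.span {a} • ⊤ : Submodule R M) ↔ ∃ m', a • m' = m := by
  rw [Submodule.ideal_span_singleton_smul, Submodule.mem_smul_pointwise_iff_exists]
  simp

theorem smodEq_span_pow_iff {n : ℕ} {x y : R} :
    x ≡ y [SMOD (Ideal.span {r} ^ n • ⊤ : Submodule R R)] ↔ r ^ n ∣ x - y := by
  rw [SModEq.sub_mem, Ideal.span_singleton_pow, smul_eq_mul, Ideal.mul_top,
    Ideal.mem_span_singleton]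

theorem eq_zero_of_forall_pow_dvd (h : IsAdicComplete (Ideal.span {r}) R) {x : R}
    (hx : ∀ n, r ^ n ∣ x) : x = 0 :=
  h.toIsHausdorff.haus x fun n => smodEq_span_pow_iff.2 (by simpa using hx n)

/-- An approximately idempotent matrix over an `r`-adically complete ring can be corrected to an
idempotent one. -/
theorem exists_idempotent_matrix (h : IsAdicComplete (Ideal.span {r}) R) {n : ℕ}
    (E₀ : Matrix (Fin n) (Fin n) R) (h₀ : ∃ B : Matrix (Fin n) (Fin n) R, E₀ * E₀ - E₀ = r • B) :
    ∃ E : Matrix (Fin n) (Fin n) R, E * E = E ∧ ∃ C, E - E₀ = r • C := by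
  -- Newton iteration `x ↦ 3x² - 2x³` for the equation `x² = x`. The error `x² - x` gets squared, up
  -- to a factor commuting with it; linear growth of the exponent of `r` is all that is recorded.
  let e : ℕ → Matrix (Fin n) (Fin n) R :=
    fun k => Nat.rec E₀ (fun _ x => 3 • (x * x) - 2 • (x * x * x)) k
  have he0 : e 0 = E₀ := rfl
  have hes (k) : e (k + 1) = 3 • (e k * e k) - 2 • (e k * e k * e k) := rfl
  have happ (k) : ∃ B, e k * e k - e k = r ^ (k + 1) • B := by
    induction k with
    | zero => simpa [he0] using h₀
    | succ k ih =>
      obtain ⟨B, hB⟩ := ih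
      refine ⟨r ^ k • (B * B * (4 • (e k * e k) - 4 • e k - 3)), ?_⟩
      have h1 : e (k + 1) * e (k + 1) - e (k + 1) = (e k * e k - e k) * (e k * e k - e k) *
          (4 • (e k * e k) - 4 • e k - 3) := by
        rw [hes]; noncomm_ring
      rw [h1, hB, smul_mul_assoc, mul_smul_comm, smul_mul_assoc, smul_mul_assoc, smul_smul,
        smul_smul]
      congr 1
      ring
  have hstep (k) : ∃ B, e k - e (k + 1) = r ^ (k + 1) • B := by
    obtain ⟨B, hB⟩ := happ k
    refine ⟨(2 • e k - 1) * B, ?_⟩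
    rw [← mul_smul_comm, ← hB, hes]
    noncomm_ring
  have hcauchy (i j) : ∀ {m k : ℕ}, m ≤ k → r ^ m ∣ e m i j - e k i j := by
    intro m k hmk
    induction k, hmk using Nat.le_induction with
    | base => simp
    | succ k hmk ih =>
      obtain ⟨B, hB⟩ := hstep k
      have h1 := congrFun (congrFun hB i) j
      simp only [Matrix.sub_apply, Matrix.smul_apply, smul_eq_mul] at h1
      have h2 : r ^ m ∣ e k i j - e (k + 1) i j := h1 ▸
        (pow_dvd_pow r (by omega)).mul_right _
      simpa using dvd_add ih h2
  choose E hE using fun i j => h.toIsPrecomplete.prec'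
    (fun k => e k i j) fun hmk => smodEq_span_pow_iff.2 (hcauchy i j hmk)
  have hlim (k) : ∃ C : Matrix (Fin n) (Fin n) R, e k - Matrix.of E = r ^ k • C := by
    choose C hC using fun i j => smodEq_span_pow_iff.1 (hE i j k)
    exact ⟨Matrix.of C, by ext i j; simpa using hC i j⟩
  refine ⟨Matrix.of E, ?_, ?_⟩
  · rw [← sub_eq_zero]
    ext i j
    refine eq_zero_of_forall_pow_dvd h fun k => ?_
    obtain ⟨B, hB⟩ := happ k
    obtain ⟨C, hC⟩ := hlim k
    have h1 : Matrix.of E = e k - r ^ k • C := by rw [← hC]; abel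
    have h2 : Matrix.of E * Matrix.of E - Matrix.of E =
        r ^ k • (r • B - (e k * C + C * e k) + r ^ k • (C * C) + C) := by
      have h3 : (e k - r ^ k • C) * (e k - r ^ k • C) - (e k - r ^ k • C) =
          (e k * e k - e k) - (e k * (r ^ k • C) + (r ^ k • C) * e k)
            + (r ^ k • C) * (r ^ k • C) + r ^ k • C := by
        generalize r ^ k • C = Y
        noncomm_ring
      rw [h1, h3, hB, pow_succ]
      simp only [mul_smul_comm, smul_mul_assoc, smul_add, smul_sub, smul_smul]
    rw [h2]
    exact Dvd.intro _ rfl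
  -- The limit is compared with `e 1`, since the bound at index `0` only gives divisibility by `r ^
  -- 0`. The missing difference `e 0 - e 1` is already divisible by `r`.
  · obtain ⟨C, hC⟩ := hlim 1
    obtain ⟨B, hB⟩ := hstep 0
    refine ⟨-(B + C), ?_⟩
    rw [smul_neg, smul_add, ← pow_one r, ← hC]
    rw [zero_add] at hB
    rw [← hB, he0]
    abel

/-- Finite projective modules over `A = R / r` lift to finite projective modules over `R`. -/
theorem exists_projective_lift_of_surjective (h : IsAdicComplete (Ideal.span {r}) R)
    {A : Type u} [CommRing A] [Algebra R A] (hf : Function.Surjective (algebraMap R A))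
    (hf0 : ∀ x : R, algebraMap R A x = 0 ↔ r ∣ x) (W : Type u)
    [AddCommGroup W] [Module R W] [Module A W] [IsScalarTower R A W] [Module.Finite A W]
    [Module.Projective A W] :
    ∃ (P : Type u) (_ : AddCommGroup P) (_ : Module R P), Module.Finite R P ∧
      Module.Projective R P ∧ ∃ q : P →ₗ[R] W, Function.Surjective q ∧
        ∀ x, q x = 0 → ∃ y, r • y = x := by
  obtain ⟨n, π, hπ⟩ := Module.Finite.exists_fin' A W
  obtain ⟨σ, hσ⟩ := Module.projective_lifting_property π LinearMap.id hπ
  have hσ' (w) : π (σ w) = w := LinearMap.congr_fun hσ w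
  -- `W` is the image of the idempotent `σ ∘ π` on `Aⁿ`. Its matrix is lifted entrywise, corrected
  -- to an idempotent `E` over `R`, and the image of `E` is the required lift.
  let M₀ : Matrix (Fin n) (Fin n) A := LinearMap.toMatrix' (σ ∘ₗ π)
  have hM₀ (v) : M₀.mulVec v = σ (π v) := by
    rw [← Matrix.toLin'_apply, Matrix.toLin'_toMatrix']; rfl
  let f : R →+* A := algebraMap R A
  have hfr : f r = 0 := (hf0 r).2 dvd_rfl
  have hmat (X : Matrix (Fin n) (Fin n) R) (hX : X.map f = 0) : ∃ B, X = r • B := by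
    choose B hB using fun i j => (hf0 (X i j)).1 (congrFun (congrFun hX i) j)
    exact ⟨Matrix.of B, by ext i j; simpa using hB i j⟩
  let E₀ : Matrix (Fin n) (Fin n) R := M₀.map (Function.surjInv hf)
  have hE₀ : E₀.map f = M₀ := by
    ext i j; exact Function.surjInv_eq hf _
  have hM₀i : M₀ * M₀ = M₀ := by
    rw [← LinearMap.toMatrix'_mul]
    congr 1
    ext v
    simp [hσ']
  obtain ⟨E, hEi, C, hC⟩ := exists_idempotent_matrix h E₀ (hmat _ (by
    rw [← f.mapMatrix_apply, map_sub, map_mul, f.mapMatrix_apply, hE₀, hM₀i, sub_self]))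
  have hE : E.map f = M₀ := by
    have : E = E₀ + r • C := by rw [← hC]; abel
    rw [this, ← hE₀]
    ext i j
    simp [hfr]
  let red : (Fin n → R) →ₗ[R] (Fin n → A) := (Algebra.linearMap R A).compLeft (Fin n)
  have hred (v i) : red v i = f (v i) := rfl
  have hredE (v) : red (E.mulVec v) = σ (π (red v)) := by
    rw [← hM₀, ← hE]
    ext i
    rw [hred, RingHom.map_mulVec]
    rfl
  have hreds : Function.Surjective red := fun v => by
    choose x hx using fun i => hf (v i)
    exact ⟨x, funext hx⟩
  let P := LinearMap.range E.mulVecLin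
  have hEP (x : P) : E.mulVec x = x := by
    obtain ⟨_, v, rfl⟩ := x
    simp [hEi]
  let q : P →ₗ[R] W := (π.restrictScalars R) ∘ₗ red ∘ₗ P.subtype
  refine ⟨P, inferInstance, inferInstance, inferInstance,
    Module.Projective.of_split P.subtype E.mulVecLin.rangeRestrict ?_, q, fun w => ?_,
    fun x hx => ?_⟩
  · ext1 x
    exact Subtype.ext (hEP x)
  · obtain ⟨v, hv⟩ := hreds (σ w)
    refine ⟨E.mulVecLin.rangeRestrict v, ?_⟩
    change π (red (E.mulVec v)) = w
    rw [hredE, hv, hσ', hσ']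
  -- The coordinates of `x` are divisible by `r` in `Rⁿ`; applying `E`, which fixes `x`, moves the
  -- quotient back into `P`.
  · have h1 : red (E.mulVec x) = 0 := by
      rw [hredE]
      change σ (q x) = 0
      rw [hx, map_zero]
    rw [hEP] at h1
    choose y hy using fun i => (hf0 ((x : Fin n → R) i)).1 (congrFun h1 i)
    refine ⟨E.mulVecLin.rangeRestrict y, Subtype.ext ?_⟩
    change r • E.mulVec y = x
    rw [← Matrix.mulVec_smul, ← hEP x]
    congr 1
    exact (funext hy).symm

/-- Finite projective modules over `R / r` lift to finite projective modules over `R`. -/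
theorem exists_projective_lift (h : IsAdicComplete (Ideal.span {r}) R) (W : Type u)
    [AddCommGroup W] [Module R W] [Module (R ⧸ Ideal.span {r}) W]
    [IsScalarTower R (R ⧸ Ideal.span {r}) W] [Module.Finite (R ⧸ Ideal.span {r}) W]
    [Module.Projective (R ⧸ Ideal.span {r}) W] :
    ∃ (P : Type u) (_ : AddCommGroup P) (_ : Module R P), Module.Finite R P ∧
      Module.Projective R P ∧ ∃ q : P →ₗ[R] W, Function.Surjective q ∧
        ∀ x, q x = 0 → ∃ y, r • y = x :=
  exists_projective_lift_of_surjective h (A := R ⧸ Ideal.span {r}) Ideal.Quotient.mk_surjective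
    (fun _ => Ideal.Quotient.eq_zero_iff_mem.trans Ideal.mem_span_singleton) W

end Lifting

/-! ### Diagonal presentations -/

section Diagonal

variable {R : Type u} [CommRing R] {r : R}

/-- A presentation of `D` as the quotient of a finite projective module `L` by a submodule which is
diagonal with respect to a dual basis of `L`, with coefficients `0` or `r ^ (k + 1)`. -/
def HasDiagonalPresentation (r : R) (D : Type u) [AddCommGroup D] [Module R D] : Prop :=
  ∃ (L : Type u) (_ : AddCommGroup L) (_ : Module R L) (F : L →ₗ[R] D) (ι : Type) (_ : Fintype ι)
    (x : ι → L) (f : ι → L →ₗ[R] R) (t : ι → R), Module.Projective R L ∧ Function.Surjective F ∧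
    (∀ j, t j = 0 ∨ ∃ k : ℕ, t j = r ^ (k + 1)) ∧ (∀ l, ∑ j, f j l • x j = l) ∧
    (∀ l, F l = 0 → ∀ j, t j ∣ f j l) ∧ ∀ j, F (t j • x j) = 0

theorem exists_finite_dual_basis (P : Type*) [AddCommGroup P] [Module R P] [Module.Finite R P]
    [Module.Projective R P] : ∃ (n : ℕ) (x : Fin n → P) (f : Fin n → P →ₗ[R] R),
      ∀ p, ∑ j, f j p • x j = p := by
  obtain ⟨n, π, hπ⟩ := Module.Finite.exists_fin' R P
  obtain ⟨σ, hσ⟩ := Module.projective_lifting_property π LinearMap.id hπ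
  refine ⟨n, fun j => π (Pi.single j 1), fun j => LinearMap.proj j ∘ₗ σ, fun p => ?_⟩
  calc ∑ j, σ p j • π (Pi.single j 1) = π (∑ j, σ p j • Pi.single j 1) := by simp
    _ = π (σ p) := by rw [← pi_eq_sum_univ' (σ p)]
    _ = p := LinearMap.congr_fun hσ p

theorem HasDiagonalPresentation.of_surjective_of_injective {D D' : Type u} [AddCommGroup D]
    [Module R D] [AddCommGroup D'] [Module R D'] (h : HasDiagonalPresentation r D) (e : D →ₗ[R] D')
    (hs : Function.Surjective e) (hi : Function.Injective e) : HasDiagonalPresentation r D' := by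
  obtain ⟨L, _, _, F, ι, _, x, f, t, hL, hF, ht, hx, hk, hz⟩ := h
  refine ⟨L, _, _, e ∘ₗ F, ι, _, x, f, t, hL, hs.comp hF, ht, hx, fun l hl => hk l ?_, fun j => ?_⟩
  · exact hi (by rw [map_zero]; exact hl)
  · rw [LinearMap.comp_apply, hz, map_zero]

theorem mkQ_eq_zero_iff_exists_smul {M : Type*} [AddCommGroup M] [Module R M] {m : M} :
    (Ideal.span {r} • ⊤ : Submodule R M).mkQ m = 0 ↔ ∃ m', r • m' = m := by
  rw [Submodule.mkQ_apply, Submodule.Quotient.mk_eq_zero, mem_span_singleton_smul_top]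

/-- An `r`-torsion-free finite module which is projective modulo `r` has a diagonal
presentation. -/
theorem hasDiagonalPresentation_of_torsionFree (h : IsAdicComplete (Ideal.span {r}) R)
    (D : Type u) [AddCommGroup D] [Module R D] [Module.Finite R D]
    [Module.Projective (R ⧸ Ideal.span {r}) (D ⧸ (Ideal.span {r} • ⊤ : Submodule R D))]
    (htf : ∀ d : D, r • d = 0 → d = 0) : HasDiagonalPresentation r D := by
  have : Module.Finite (R ⧸ Ideal.span {r}) (D ⧸ (Ideal.span {r} • ⊤ : Submodule R D)) :=
    Module.Finite.of_restrictScalars_finite R _ _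
  obtain ⟨P, _, _, _, _, q, hq, hq0⟩ :=
    exists_projective_lift h (D ⧸ (Ideal.span {r} • ⊤ : Submodule R D))
  obtain ⟨F, hF⟩ := Module.projective_lifting_property
    (Ideal.span {r} • ⊤ : Submodule R D).mkQ q (Submodule.mkQ_surjective _)
  have hF' (p) : (Ideal.span {r} • ⊤ : Submodule R D).mkQ (F p) = q p := LinearMap.congr_fun hF p
  obtain ⟨n, x, f, hx⟩ := exists_finite_dual_basis (R := R) P
  -- A kernel element dies modulo `r`, so it is `r • y`; torsion-freeness puts `y` in the kernel
  -- again. Iterating, the kernel lies in every `r ^ k P`, so its coordinates vanish by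
  -- separatedness and all coefficients can be taken to be `0`.
  have hker (k : ℕ) (p) (hp : F p = 0) : ∃ p', r ^ k • p' = p ∧ F p' = 0 := by
    induction k with
    | zero => exact ⟨p, by simp, hp⟩
    | succ k ih =>
      obtain ⟨p', rfl, hp'⟩ := ih
      obtain ⟨y, rfl⟩ := hq0 p' (by rw [← hF', hp', map_zero])
      exact ⟨y, by rw [pow_succ, smul_smul], htf _ (by rw [← map_smul, hp'])⟩
  refine ⟨P, _, _, F, Fin n, _, x, f, fun _ => 0, ‹_›, ?_, fun _ => Or.inl rfl, hx,
    fun p hp j => ?_, fun j => by simp⟩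
  -- Nakayama: `r` lies in the Jacobson radical by completeness, and `F` is surjective modulo `r`.
  · rw [← LinearMap.range_eq_top, ← top_le_iff]
    refine Submodule.le_of_le_smul_of_le_jacobson_bot (I := Ideal.span {r}) Module.Finite.fg_top
      h.le_jacobson_bot fun d _ => ?_
    obtain ⟨p, hp⟩ := hq ((Ideal.span {r} • ⊤ : Submodule R D).mkQ d)
    rw [← hF', ← sub_eq_zero, ← map_sub] at hp
    obtain ⟨d', hd'⟩ := mkQ_eq_zero_iff_exists_smul.1 hp
    rw [show d = F p - r • d' by rw [hd']; abel]
    refine Submodule.sub_mem _ (Submodule.mem_sup_left ⟨p, rfl⟩)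
      (Submodule.mem_sup_right (mem_span_singleton_smul_top.2 ⟨d', rfl⟩))
  · rw [eq_zero_of_forall_pow_dvd h (x := f j p)]
    intro k
    obtain ⟨p', rfl, -⟩ := hker k p hp
    rw [map_smul]
    exact Dvd.intro _ rfl

/-- If multiplication by `r` on `D` factors through an embedded quotient `D'` with a diagonal
presentation, and `D` and `D'` are projective modulo `r`, then `D` has a diagonal presentation. -/
theorem HasDiagonalPresentation.of_smul (h : IsAdicComplete (Ideal.span {r}) R)
    {D D' : Type u} [AddCommGroup D] [Module R D] [AddCommGroup D'] [Module R D']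
    (hD' : HasDiagonalPresentation r D')
    (hf : Module.Finite (R ⧸ Ideal.span {r}) (D ⧸ (Ideal.span {r} • ⊤ : Submodule R D)))
    (hp : Module.Projective (R ⧸ Ideal.span {r}) (D ⧸ (Ideal.span {r} • ⊤ : Submodule R D)))
    (hp' : Module.Projective (R ⧸ Ideal.span {r}) (D' ⧸ (Ideal.span {r} • ⊤ : Submodule R D')))
    (ρ : D →ₗ[R] D') (hρ : Function.Surjective ρ) (i : D' →ₗ[R] D) (hi : Function.Injective i)
    (hiρ : ∀ d, i (ρ d) = r • d) : HasDiagonalPresentation r D := by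
  let π := (Ideal.span {r} • ⊤ : Submodule R D).mkQ
  let π' := (Ideal.span {r} • ⊤ : Submodule R D').mkQ
  have hπ : Function.Surjective π := Submodule.mkQ_surjective _
  have hπ0 {d} : π d = 0 ↔ ∃ d', r • d' = d := mkQ_eq_zero_iff_exists_smul
  have hπ0' {d} : π' d = 0 ↔ ∃ d', r • d' = d := mkQ_eq_zero_iff_exists_smul
  let μ₀ : (D ⧸ (Ideal.span {r} • ⊤ : Submodule R D)) →ₗ[R]
      (D' ⧸ (Ideal.span {r} • ⊤ : Submodule R D')) := Submodule.mapQ _ _ ρ (by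
    intro d hd
    obtain ⟨d', rfl⟩ := mem_span_singleton_smul_top.1 hd
    exact mem_span_singleton_smul_top.2 ⟨ρ d', (map_smul _ _ _).symm⟩)
  let μ : (D ⧸ (Ideal.span {r} • ⊤ : Submodule R D)) →ₗ[R ⧸ Ideal.span {r}]
      (D' ⧸ (Ideal.span {r} • ⊤ : Submodule R D')) :=
    μ₀.extendScalarsOfSurjective Ideal.Quotient.mk_surjective
  have hμ (d) : μ (π d) = π' (ρ d) := rfl
  have hμs : Function.Surjective μ := by
    intro v
    obtain ⟨d', rfl⟩ := Submodule.mkQ_surjective _ v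
    obtain ⟨d, rfl⟩ := hρ d'
    exact ⟨π d, hμ d⟩
  -- Projectivity of `D' / r D'` splits `μ`, so its kernel `W` is a direct summand of `D / r D`,
  -- hence finite projective and liftable to `R`.
  obtain ⟨σ, hσ⟩ := Module.projective_lifting_property μ LinearMap.id hμs
  have hσ' (v) : μ (σ v) = v := LinearMap.congr_fun hσ v
  let W := LinearMap.ker μ
  let pr : (D ⧸ (Ideal.span {r} • ⊤ : Submodule R D)) →ₗ[R ⧸ Ideal.span {r}] W :=
    (LinearMap.id - σ ∘ₗ μ).codRestrict W fun v => by simp [W, hσ']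
  have hpr : pr ∘ₗ W.subtype = LinearMap.id := by
    ext1 x
    refine Subtype.ext ?_
    have hx : μ x = 0 := x.2
    simp [pr, hx]
  have : Module.Projective (R ⧸ Ideal.span {r}) W := Module.Projective.of_split _ pr hpr
  have : Module.Finite (R ⧸ Ideal.span {r}) W :=
    Module.Finite.of_surjective pr fun x => ⟨x, LinearMap.congr_fun hpr x⟩
  obtain ⟨P, _, _, _, _, q, hq, hq0⟩ := exists_projective_lift h W
  obtain ⟨w₀, hw₀⟩ := Module.projective_lifting_property π
    (W.subtype.restrictScalars R ∘ₗ q) hπ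
  have hw₀' (p) : π (w₀ p) = q p := LinearMap.congr_fun hw₀ p
  let ρr : D →ₗ[R] D' := r • ρ
  -- The naive lift `w₀` sends `P` to elements whose image under `ρ` is only in `r D'`. Writing `ρ ∘
  -- w₀ = r (ρ ∘ g)` and subtracting `r g` gives a lift `w` with values in `ker ρ`, that is, in the
  -- `r`-torsion.
  obtain ⟨g, hg⟩ := Module.projective_lifting_property ρr.rangeRestrict
    ((ρ ∘ₗ w₀).codRestrict (LinearMap.range ρr) fun p => by
      have h1 : π' (ρ (w₀ p)) = 0 := by rw [← hμ, hw₀']; exact (q p).2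
      obtain ⟨d', hd'⟩ := hπ0'.1 h1
      obtain ⟨d, rfl⟩ := hρ d'
      exact ⟨d, hd'⟩) ρr.surjective_rangeRestrict
  have hg' (p) : r • ρ (g p) = ρ (w₀ p) := congrArg Subtype.val (LinearMap.congr_fun hg p)
  let w : P →ₗ[R] D := w₀ - r • g
  have hρw (p) : ρ (w p) = 0 := by
    simp only [w, LinearMap.sub_apply, LinearMap.smul_apply, map_sub, map_smul, hg', sub_self]
  have hrw (p) : r • w p = 0 := by rw [← hiρ, hρw, map_zero]
  have hπw (p) : π (w p) = q p := by
    rw [← hw₀', ← sub_eq_zero, ← map_sub]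
    exact hπ0.2 ⟨-g p, by simp [w]⟩
  obtain ⟨L, _, _, F, ι, _, x, f, t, hL, hF, ht, hx, hk, hz⟩ := hD'
  obtain ⟨G, hG⟩ := Module.projective_lifting_property ρ F hρ
  have hG' (l) : ρ (G l) = F l := LinearMap.congr_fun hG l
  have hrG (l) : r • G l = i (F l) := by rw [← hiρ, hG']
  obtain ⟨n, y, g', hy⟩ := exists_finite_dual_basis (R := R) P
  -- The old relations are multiplied by `r` because `r G = i F`, and each new generator from `P`
  -- has relation `r` because `r w = 0`.
  refine ⟨L × P, _, _, G.coprod w, ι ⊕ Fin n, inferInstance,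
    Sum.elim (fun j => (x j, 0)) (fun j => (0, y j)),
    Sum.elim (fun j => f j ∘ₗ LinearMap.fst R L P) (fun j => g' j ∘ₗ LinearMap.snd R L P),
    Sum.elim (fun j => r * t j) (fun _ => r), inferInstance, fun d => ?_, ?_, ?_, ?_, ?_⟩
  · obtain ⟨l, hl⟩ := hF (ρ d)
    have h1 : π (d - G l) ∈ W := by
      change μ _ = 0
      rw [hμ, map_sub, hG', hl, sub_self, map_zero]
    obtain ⟨p, hp⟩ := hq ⟨_, h1⟩
    have h2 : π (d - G l - w p) = 0 := by rw [map_sub, hπw, hp, sub_self]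
    obtain ⟨d', hd'⟩ := hπ0.1 h2
    obtain ⟨l', hl'⟩ := hF (ρ d')
    refine ⟨(l + r • l', p), ?_⟩
    rw [LinearMap.coprod_apply, map_add, map_smul, hrG, hl', hiρ, hd']
    abel
  · rintro (j | j)
    · rcases ht j with hj | ⟨k, hj⟩
      · exact Or.inl (by simp [hj])
      · exact Or.inr ⟨k + 1, by simp [hj, pow_succ']⟩
    · exact Or.inr ⟨0, by simp⟩
  · rintro ⟨l, p⟩
    simp only [Fintype.sum_sum_type, Sum.elim_inl, Sum.elim_inr, LinearMap.comp_apply,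
      LinearMap.fst_apply, LinearMap.snd_apply, Prod.smul_mk, smul_zero]
    ext
    · simp [Prod.fst_sum, hx]
    · simp [Prod.snd_sum, hy]
  · rintro ⟨l, p⟩ hlp
    rw [LinearMap.coprod_apply] at hlp
    have hFl : F l = 0 := by
      have := congrArg ρ hlp
      rwa [map_add, hρw, add_zero, map_zero, hG'] at this
    -- This is why the nonzero coefficients are `r ^ (k + 1)` rather than `r ^ k`: every `t j` is
    -- divisible by `r`, so the coordinates of `l` are too.
    have hrl : ∃ l', r • l' = l := by
      have h1 (j) : ∃ a, f j l = r * a := by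
        refine dvd_trans ?_ (hk l hFl j)
        rcases ht j with hj | ⟨k, hj⟩
        · exact hj ▸ dvd_zero r
        · exact hj ▸ Dvd.intro_left _ (pow_succ r k).symm
      choose a ha using h1
      refine ⟨∑ j, a j • x j, ?_⟩
      rw [Finset.smul_sum]
      simp_rw [smul_smul, ← ha]
      exact hx l
    obtain ⟨l', rfl⟩ := hrl
    have hqp : q p = 0 := by
      refine Subtype.ext ?_
      rw [← hπw]
      refine hπ0.2 ⟨-G l', ?_⟩
      rw [smul_neg, ← map_smul]
      exact (eq_neg_of_add_eq_zero_right hlp).symm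
    obtain ⟨p', rfl⟩ := hq0 p hqp
    have hFl' : F l' = 0 := hi (by
      rw [map_zero, ← hrG, ← map_smul]
      rwa [map_smul w, hrw, add_zero] at hlp)
    rintro (j | j)
    · simpa using mul_dvd_mul_left r (hk l' hFl' j)
    · simp
  · rintro (j | j)
    · rw [Sum.elim_inl, Sum.elim_inl, Prod.smul_mk, smul_zero, LinearMap.coprod_apply, map_zero,
        add_zero, mul_smul, map_smul, hrG, hz, map_zero]
    · rw [Sum.elim_inr, Sum.elim_inr, Prod.smul_mk, smul_zero, LinearMap.coprod_apply, map_zero,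
        zero_add, map_smul, hrw]

/-- Descending induction on the submodules `r ^ n D`, starting at an exponent `N` that kills the
torsion and ending at `n = 0`; `k` counts the steps down from `N`. -/
theorem HasFiniteProjectiveMuDevissage.hasDiagonalPresentation
    (h : IsAdicComplete (Ideal.span {r}) R) (D : Type u) [AddCommGroup D] [Module R D]
    [Module.Finite R D] (hD : HasFiniteProjectiveMuDevissage r D) (ht : HasBoundedTorsion r D) :
    HasDiagonalPresentation r D := by
  obtain ⟨N, hN⟩ := ht
  have hmem {n : ℕ} {d : D} : d ∈ powSubmodule r D n ↔ ∃ d', r ^ n • d' = d :=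
    mem_span_singleton_smul_top
  have hall (k : ℕ) : k ≤ N → HasDiagonalPresentation r (powSubmodule r D (N - k)) := by
    induction k with
    | zero =>
      intro _
      have : Module.Finite R (powSubmodule r D (N - 0)) :=
        Module.Finite.of_surjective (M := D)
          ((LinearMap.lsmul R D (r ^ (N - 0))).codRestrict _ fun d => hmem.2 ⟨d, rfl⟩) (by
            rintro ⟨d, hd⟩
            obtain ⟨d', rfl⟩ := hmem.1 hd
            exact ⟨d', rfl⟩)
      have := (hD (N - 0)).2.1
      refine hasDiagonalPresentation_of_torsionFree h _ ?_
      rintro ⟨d, hd⟩ hrd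
      obtain ⟨d', rfl⟩ := hmem.1 hd
      -- An element of `r ^ N D` killed by `r` comes from a `d'` killed by `r ^ (N + 1)`, hence
      -- already by `r ^ N`.
      have h1 : r • r ^ N • d' = 0 := congrArg Subtype.val hrd
      exact Subtype.ext (hN d' ⟨N + 1, by rwa [pow_succ', mul_smul]⟩)
    | succ k ih =>
      intro hk
      have h1 := ih (by omega)
      obtain ⟨m, hm⟩ : ∃ m, m = N - (k + 1) := ⟨_, rfl⟩
      rw [show N - k = m + 1 by omega] at h1
      rw [← hm]
      have hle : powSubmodule r D (m + 1) ≤ powSubmodule r D m := fun d hd => by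
        obtain ⟨d', rfl⟩ := hmem.1 hd
        exact hmem.2 ⟨r • d', by rw [smul_smul, pow_succ]⟩
      refine h1.of_smul h (hD m).1 (hD m).2.1 (hD (m + 1)).2.1
        ((LinearMap.lsmul R D r ∘ₗ Submodule.subtype _).codRestrict _ ?_) ?_
        (Submodule.inclusion hle) (Submodule.inclusion_injective hle) fun d => rfl
      · rintro ⟨d, hd⟩
        obtain ⟨d', rfl⟩ := hmem.1 hd
        exact hmem.2 ⟨d', by rw [pow_succ', mul_smul]; rfl⟩
      · rintro ⟨d, hd⟩
        obtain ⟨d', rfl⟩ := hmem.1 hd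
        exact ⟨⟨r ^ m • d', hmem.2 ⟨d', rfl⟩⟩, Subtype.ext
          (by rw [pow_succ', mul_smul] : r • r ^ m • d' = r ^ (m + 1) • d')⟩
  have h0 := hall N le_rfl
  rw [Nat.sub_self] at h0
  exact h0.of_surjective_of_injective (Submodule.subtype _)
    (fun d => ⟨⟨d, hmem.2 ⟨d, by simp⟩⟩, rfl⟩) Subtype.val_injective

/-- `M` is a retract of a finite direct sum of cyclic modules `R / t` with `t = 0` or
`t = r ^ k`. -/
def IsCyclicRetract (r : R) (M : Type*) [AddCommGroup M] [Module R M] : Prop :=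
  ∃ (ι : Type) (_ : Fintype ι) (t : ι → R) (i : ∀ j, M →ₗ[R] R ⧸ Ideal.span {t j})
    (p : ∀ j, (R ⧸ Ideal.span {t j}) →ₗ[R] M), (∀ j, t j = 0 ∨ ∃ k : ℕ, t j = r ^ k) ∧
      ∑ j, p j ∘ₗ i j = LinearMap.id

/-- The dual basis of `L` descends: `f j` modulo `t j` kills `ker F`, and `1 ↦ F (x j)` is well
defined on `R / t j`. The expansion of `l` in the dual basis becomes the retraction identity. -/
theorem HasDiagonalPresentation.isCyclicRetract {D : Type u} [AddCommGroup D] [Module R D]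
    (h : HasDiagonalPresentation r D) : IsCyclicRetract r D := by
  obtain ⟨L, _, _, F, ι, _, x, f, t, hL, hF, ht, hx, hk, hz⟩ := h
  let i₀ (j) : L →ₗ[R] R ⧸ Ideal.span {t j} := (Ideal.span {t j}).mkQ ∘ₗ f j
  have hi₀ (j) : LinearMap.ker F ≤ LinearMap.ker (i₀ j) := fun l hl =>
    Ideal.Quotient.eq_zero_iff_mem.2 (Ideal.mem_span_singleton.2 (hk l hl j))
  let e := F.quotKerEquivOfSurjective hF
  let i (j) : D →ₗ[R] R ⧸ Ideal.span {t j} :=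
    (LinearMap.ker F).liftQ (i₀ j) (hi₀ j) ∘ₗ e.symm.toLinearMap
  have hi (j l) : i j (F l) = (Ideal.span {t j}).mkQ (f j l) := by
    have : e.symm (F l) = Submodule.Quotient.mk l := e.symm_apply_eq.2 rfl
    simp [i, this, i₀]
  let p (j) : (R ⧸ Ideal.span {t j}) →ₗ[R] D :=
    (Ideal.span {t j}).liftQ (LinearMap.toSpanSingleton R D (F (x j))) (by
      rw [Ideal.span_le, Set.singleton_subset_iff]
      change t j • F (x j) = 0
      rw [← map_smul, hz])
  refine ⟨ι, inferInstance, t, i, p, fun j => (ht j).imp_right fun ⟨k, hk⟩ => ⟨k + 1, hk⟩, ?_⟩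
  ext d
  obtain ⟨l, rfl⟩ := hF d
  simp only [LinearMap.sum_apply, LinearMap.comp_apply, hi, LinearMap.id_apply]
  conv_rhs => rw [← hx l, map_sum]
  refine Finset.sum_congr rfl fun j _ => ?_
  rw [map_smul]
  rfl

end Diagonal

/-! ### Retracts of direct sums of cyclic modules -/

section CyclicRetract

variable {R : Type u} [CommRing R] {r : R}

theorem pow_mul_cancel {B : Type*} [CommRing B] {b : B} (hb : ∀ x, b * x = 0 → x = 0) {n : ℕ}
    {x : B} (h : b ^ n * x = 0) : x = 0 := by
  induction n with
  | zero => simpa using h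
  | succ n ih => exact ih (hb _ (by rw [← h]; ring))

theorem IsCyclicRetract.of_sum {M : Type*} [AddCommGroup M] [Module R M] {κ : Type} [Fintype κ]
    {N : κ → Type*} [∀ k, AddCommGroup (N k)] [∀ k, Module R (N k)] (i : ∀ k, M →ₗ[R] N k)
    (p : ∀ k, N k →ₗ[R] M) (hpi : ∑ k, p k ∘ₗ i k = LinearMap.id)
    (h : ∀ k, IsCyclicRetract r (N k)) : IsCyclicRetract r M := by
  choose ι hι t i' p' ht h' using h
  refine ⟨Σ k, ι k, inferInstance, fun x => t x.1 x.2, fun x => i' x.1 x.2 ∘ₗ i x.1,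
    fun x => p x.1 ∘ₗ p' x.1 x.2, fun x => ht x.1 x.2, ?_⟩
  rw [Fintype.sum_sigma, ← hpi]
  refine Finset.sum_congr rfl fun k _ => ?_
  ext m
  have h1 := LinearMap.congr_fun (h' k) (i k m)
  simp only [LinearMap.sum_apply, LinearMap.comp_apply, LinearMap.id_apply] at h1 ⊢
  exact (map_sum (p k) _ _).symm.trans (congrArg (p k) h1)

theorem IsCyclicRetract.of_retract {M N : Type*} [AddCommGroup M] [Module R M] [AddCommGroup N]
    [Module R N] (h : IsCyclicRetract r N) (i : M →ₗ[R] N) (p : N →ₗ[R] M)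
    (hpi : p ∘ₗ i = LinearMap.id) : IsCyclicRetract r M :=
  .of_sum (κ := Unit) (fun _ => i) (fun _ => p) (by simpa using hpi) fun _ => h

theorem isCyclicRetract_quotient {t : R} (ht : t = 0 ∨ ∃ k : ℕ, t = r ^ k) :
    IsCyclicRetract r (R ⧸ Ideal.span {t}) :=
  ⟨Unit, inferInstance, fun _ => t, fun _ => LinearMap.id, fun _ => LinearMap.id, fun _ => ht,
    by ext; simp⟩

theorem isCyclicRetract_self : IsCyclicRetract r R :=
  (isCyclicRetract_quotient (Or.inl rfl)).of_retract
    (Submodule.mkQ (Ideal.span {(0 : R)}))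
    ((Ideal.span {(0 : R)}).liftQ LinearMap.id (by simp)) (LinearMap.ext fun _ => rfl)

/-! ### Maps, tensor products and Hom modules of cyclic modules -/

theorem quotient_smul_self {t : R} (x : R ⧸ Ideal.span {t}) : t • x = 0 := by
  obtain ⟨x, rfl⟩ := Ideal.Quotient.mk_surjective x
  exact Ideal.Quotient.eq_zero_iff_mem.2 (Ideal.mem_span_singleton.2 (Dvd.intro _ rfl))

theorem quotient_smul_of_dvd {t a : R} (h : t ∣ a) (x : R ⧸ Ideal.span {t}) : a • x = 0 := by
  obtain ⟨b, rfl⟩ := h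
  rw [mul_comm, mul_smul, quotient_smul_self, smul_zero]

/-- The linear map `R / t → M` given by an element killed by `t`. -/
def quotientLift {M : Type*} [AddCommGroup M] [Module R M] {t : R} (m : M) (h : t • m = 0) :
    (R ⧸ Ideal.span {t}) →ₗ[R] M :=
  (Ideal.span {t}).liftQ (LinearMap.toSpanSingleton R M m) (by
    rw [Ideal.span_le, Set.singleton_subset_iff]
    exact h)

theorem quotientLift_mk {M : Type*} [AddCommGroup M] [Module R M] {t : R} (m : M) (h : t • m = 0)
    (a : R) : quotientLift m h (Ideal.Quotient.mk _ a) = a • m := rfl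

theorem quotientLift_one {M : Type*} [AddCommGroup M] [Module R M] {t : R} (m : M)
    (h : t • m = 0) : quotientLift m h 1 = m :=
  (quotientLift_mk m h 1).trans (one_smul _ _)

theorem quotient_hom_ext {M : Type*} [AddCommGroup M] [Module R M] {t : R}
    {f g : (R ⧸ Ideal.span {t}) →ₗ[R] M} (h : f 1 = g 1) : f = g := by
  ext
  exact h

/-- Since `t` kills `R / u`, the tensor product is `R / u` via `a ⊗ y ↦ a y`, with inverse `y ↦ 1 ⊗
y`. -/
theorem isCyclicRetract_tensor_quotient_of_dvd {t u : R} (hu : u = 0 ∨ ∃ k : ℕ, u = r ^ k)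
    (h : u ∣ t) : IsCyclicRetract r ((R ⧸ Ideal.span {t}) ⊗[R] (R ⧸ Ideal.span {u})) := by
  refine (isCyclicRetract_quotient hu).of_retract
    (TensorProduct.lift (quotientLift LinearMap.id 
      (LinearMap.ext (quotient_smul_of_dvd h))))
    (TensorProduct.mk R _ _ 1) ?_
  refine TensorProduct.ext' fun x y => ?_
  obtain ⟨a, rfl⟩ := Ideal.Quotient.mk_surjective x
  change 1 ⊗ₜ[R] (a • y) = _
  rw [← TensorProduct.smul_tmul]
  change Ideal.Quotient.mk _ (a * 1) ⊗ₜ[R] y = _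
  rw [mul_one]
  rfl

theorem dvd_or_dvd {t u : R} (ht : t = 0 ∨ ∃ k : ℕ, t = r ^ k)
    (hu : u = 0 ∨ ∃ k : ℕ, u = r ^ k) : t ∣ u ∨ u ∣ t := by
  rcases ht with rfl | ⟨k, rfl⟩
  · exact Or.inr (dvd_zero _)
  rcases hu with rfl | ⟨l, rfl⟩
  · exact Or.inl (dvd_zero _)
  exact (le_total k l).imp (pow_dvd_pow r) (pow_dvd_pow r)

theorem isCyclicRetract_tensor_quotient {t u : R} (ht : t = 0 ∨ ∃ k : ℕ, t = r ^ k)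
    (hu : u = 0 ∨ ∃ k : ℕ, u = r ^ k) :
    IsCyclicRetract r ((R ⧸ Ideal.span {t}) ⊗[R] (R ⧸ Ideal.span {u})) := by
  rcases dvd_or_dvd ht hu with h | h
  · exact (isCyclicRetract_tensor_quotient_of_dvd ht h).of_retract
      (TensorProduct.comm R _ _).toLinearMap (TensorProduct.comm R _ _).toLinearMap
      (TensorProduct.ext rfl)
  · exact isCyclicRetract_tensor_quotient_of_dvd hu h

theorem sum_map_comp_map {M N : Type*} [AddCommGroup M] [Module R M] [AddCommGroup N] [Module R N]
    {ι κ : Type} [Fintype ι] [Fintype κ] {X : ι → Type*} {Y : κ → Type*}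
    [∀ j, AddCommGroup (X j)] [∀ j, Module R (X j)] [∀ k, AddCommGroup (Y k)]
    [∀ k, Module R (Y k)] {i : ∀ j, M →ₗ[R] X j} {p : ∀ j, X j →ₗ[R] M}
    {i' : ∀ k, N →ₗ[R] Y k} {p' : ∀ k, Y k →ₗ[R] N}
    (h : ∑ j, p j ∘ₗ i j = LinearMap.id) (h' : ∑ k, p' k ∘ₗ i' k = LinearMap.id) :
    ∑ x : ι × κ, TensorProduct.map (p x.1) (p' x.2) ∘ₗ TensorProduct.map (i x.1) (i' x.2) =
      LinearMap.id := by
  refine TensorProduct.ext' fun m n => ?_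
  have h1 := LinearMap.congr_fun h m
  have h2 := LinearMap.congr_fun h' n
  simp only [LinearMap.sum_apply, LinearMap.comp_apply, LinearMap.id_apply,
    TensorProduct.map_tmul, Fintype.sum_prod_type] at h1 h2 ⊢
  conv_rhs => rw [← h1, ← h2, TensorProduct.sum_tmul]
  exact Finset.sum_congr rfl fun j _ => by rw [TensorProduct.tmul_sum]

theorem IsCyclicRetract.tensor {M N : Type*} [AddCommGroup M] [Module R M] [AddCommGroup N]
    [Module R N] (hM : IsCyclicRetract r M) (hN : IsCyclicRetract r N) :
    IsCyclicRetract r (M ⊗[R] N) := by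
  obtain ⟨ι, _, t, i, p, ht, h⟩ := hM
  obtain ⟨κ, _, u, i', p', hu, h'⟩ := hN
  exact .of_sum (κ := ι × κ) (fun x => TensorProduct.map (i x.1) (i' x.2))
    (fun x => TensorProduct.map (p x.1) (p' x.2)) (sum_map_comp_map h h')
    fun x => isCyclicRetract_tensor_quotient (ht x.1) (hu x.2)

/-- For `t` and `u` in `{0, r ^ k}`, the colon of `u` by `t` is generated by `u` and some `c`, and
the colon of `u` by `c` by some `d` of the same form as `t` and `u`. This holds in every algebra
in which `r` is not a zero divisor. -/
theorem exists_colon_generator {t u : R} (ht : t = 0 ∨ ∃ k : ℕ, t = r ^ k)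
    (hu : u = 0 ∨ ∃ k : ℕ, u = r ^ k) :
    ∃ c d : R, (d = 0 ∨ ∃ k : ℕ, d = r ^ k) ∧ u ∣ t * c ∧ u ∣ c * d ∧
      ∀ (T : Type u) [CommRing T] [Algebra R T], (∀ x, algebraMap R T r * x = 0 → x = 0) →
        (∀ x, algebraMap R T u ∣ algebraMap R T t * x →
          ∃ y, algebraMap R T u ∣ x - algebraMap R T c * y) ∧
        ∀ y, algebraMap R T u ∣ algebraMap R T c * y → algebraMap R T d ∣ y := by
  rcases ht with rfl | ⟨k, rfl⟩
  -- In each case `1 ↦ c` generates `Hom(R / t, R / u)` and has annihilator `d`. The pair is chosen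
  -- before `T`, so that it serves both `R` and its base change along `φ_s`. Here `t = 0` and the
  -- colon is everything.
  · exact ⟨1, u, hu, by simp, by simp, fun T _ _ _ => ⟨fun x _ => ⟨x, by simp⟩,
      fun y hy => by simpa using hy⟩⟩
  rcases hu with rfl | ⟨l, rfl⟩
  · refine ⟨0, 1, Or.inr ⟨0, by simp⟩, by simp, by simp, fun T _ _ hT =>
      ⟨fun x hx => ⟨0, ?_⟩, fun y _ => by simp⟩⟩
    rw [map_zero, zero_dvd_iff, map_pow] at hx
    simp [pow_mul_cancel hT hx]
  rcases le_total k l with hkl | hkl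
  -- Here `t = r ^ k` and `u = r ^ (k + m)`: the colon of `u` by `t` is generated by `r ^ m`, and
  -- that of `u` by `r ^ m` is generated by `r ^ k`.
  · obtain ⟨m, rfl⟩ := Nat.exists_eq_add_of_le hkl
    refine ⟨r ^ m, r ^ k, Or.inr ⟨k, rfl⟩, by rw [pow_add], by rw [pow_add, mul_comm],
      fun T _ _ hT => ⟨fun x hx => ?_, fun y hy => ?_⟩⟩
    · obtain ⟨y, hy⟩ := hx
      refine ⟨y, ?_⟩
      rw [pow_mul_cancel hT (n := k) (x := x - algebraMap R T (r ^ m) * y)]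
      · exact dvd_zero _
      · simp only [map_pow] at hy ⊢
        rw [mul_sub, hy]
        ring
    · obtain ⟨z, hz⟩ := hy
      refine ⟨z, sub_eq_zero.1 (pow_mul_cancel (n := m) hT ?_)⟩
      simp only [map_pow] at hz ⊢
      rw [mul_sub, hz]
      ring
  · exact ⟨1, r ^ l, Or.inr ⟨l, rfl⟩, by simpa using pow_dvd_pow r hkl, by simp,
      fun T _ _ _ => ⟨fun x _ => ⟨x, by simp⟩, fun y hy => by simpa using hy⟩⟩

/-- A map out of `R / t` is its value at `1`, an element of the colon of `u` by `t` modulo `u`. That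
module is generated by `c` with annihilator `d`, so the Hom module is isomorphic to `R / d`. -/
theorem isCyclicRetract_hom_quotient (hr : ∀ x : R, r * x = 0 → x = 0) {t u : R}
    (ht : t = 0 ∨ ∃ k : ℕ, t = r ^ k) (hu : u = 0 ∨ ∃ k : ℕ, u = r ^ k) :
    IsCyclicRetract r ((R ⧸ Ideal.span {t}) →ₗ[R] (R ⧸ Ideal.span {u})) := by
  obtain ⟨c, d, hd, htc, hcd, hT⟩ := exists_colon_generator ht hu
  obtain ⟨h1, h2⟩ := hT R hr
  have hmk {a : R} : Ideal.Quotient.mk (Ideal.span {u}) a = 0 ↔ u ∣ a :=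
    Ideal.Quotient.eq_zero_iff_mem.trans Ideal.mem_span_singleton
  have hsm (a b : R) : a • Ideal.Quotient.mk (Ideal.span {u}) b = Ideal.Quotient.mk _ (a * b) :=
    rfl
  let h₀ : (R ⧸ Ideal.span {t}) →ₗ[R] (R ⧸ Ideal.span {u}) :=
    quotientLift (Ideal.Quotient.mk _ c) (by rw [hsm, hmk]; exact htc)
  have hh₀ (a : R) : (a • h₀) 1 = Ideal.Quotient.mk _ (a * c) := by
    rw [LinearMap.smul_apply, quotientLift_one, hsm]
  let e : (R ⧸ Ideal.span {d}) →ₗ[R] ((R ⧸ Ideal.span {t}) →ₗ[R] (R ⧸ Ideal.span {u})) :=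
    quotientLift h₀ (quotient_hom_ext (by
      rw [hh₀, LinearMap.zero_apply, hmk, mul_comm]; exact hcd))
  have he : Function.Bijective e := by
    refine ⟨(injective_iff_map_eq_zero e).2 fun x hx => ?_, fun g => ?_⟩
    · obtain ⟨a, rfl⟩ := Ideal.Quotient.mk_surjective x
      have h3 := LinearMap.congr_fun hx 1
      rw [quotientLift_mk, hh₀, LinearMap.zero_apply, hmk, mul_comm] at h3
      exact Ideal.Quotient.eq_zero_iff_mem.2 (Ideal.mem_span_singleton.2 (h2 a h3))
    · obtain ⟨a, ha⟩ := Ideal.Quotient.mk_surjective (g 1)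
      have h3 : u ∣ t * a := by
        rw [← hmk, ← hsm, ha, ← map_smul, quotient_smul_self, map_zero]
      obtain ⟨y, hy⟩ := h1 a h3
      refine ⟨Ideal.Quotient.mk _ y, quotient_hom_ext ?_⟩
      rw [quotientLift_mk, hh₀, ← ha, eq_comm, ← sub_eq_zero, ← map_sub, hmk, mul_comm y]
      exact hy
  let e' := LinearEquiv.ofBijective e he
  exact (isCyclicRetract_quotient hd).of_retract e'.symm.toLinearMap e'.toLinearMap
    (LinearMap.ext e'.apply_symm_apply)

theorem IsCyclicRetract.hom (hr : ∀ x : R, r * x = 0 → x = 0) {M N : Type*} [AddCommGroup M]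
    [Module R M] [AddCommGroup N] [Module R N] (hM : IsCyclicRetract r M)
    (hN : IsCyclicRetract r N) : IsCyclicRetract r (M →ₗ[R] N) := by
  obtain ⟨ι, _, t, i, p, ht, h⟩ := hM
  obtain ⟨κ, _, u, i', p', hu, h'⟩ := hN
  refine .of_sum (κ := ι × κ)
    (N := fun x => (R ⧸ Ideal.span {t x.1}) →ₗ[R] (R ⧸ Ideal.span {u x.2}))
    (fun x => LinearMap.lcomp R _ (p x.1) ∘ₗ LinearMap.llcomp R M N _ (i' x.2))
    (fun x => LinearMap.lcomp R _ (i x.1) ∘ₗ LinearMap.llcomp R _ _ N (p' x.2)) ?_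
    fun x => isCyclicRetract_hom_quotient hr (ht x.1) (hu x.2)
  ext f m
  have h1 := LinearMap.congr_fun h m
  have h2 (n) := LinearMap.congr_fun h' n
  simp only [LinearMap.sum_apply, LinearMap.comp_apply, LinearMap.id_apply] at h1 h2
  simp only [LinearMap.sum_apply, LinearMap.comp_apply, LinearMap.id_apply, LinearMap.lcomp_apply,
    LinearMap.llcomp_apply, Fintype.sum_prod_type]
  rw [Finset.sum_congr rfl fun j _ => h2 (f (p j (i j m)))]
  exact (map_sum f _ _).symm.trans (congrArg f h1)

/-! ### Bounded torsion and finite presentation of retracts -/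

theorem IsCyclicRetract.hasBoundedTorsion (hr : ∀ x : R, r * x = 0 → x = 0) {M : Type*}
    [AddCommGroup M] [Module R M] (h : IsCyclicRetract r M) : HasBoundedTorsion r M := by
  obtain ⟨ι, _, t, i, p, ht, h⟩ := h
  have hk (j) : ∃ k : ℕ, ∀ x : R ⧸ Ideal.span {t j}, (∃ n : ℕ, r ^ n • x = 0) → r ^ k • x = 0 := by
    rcases ht j with hj | ⟨k, hj⟩
    · refine ⟨0, fun x ⟨n, hn⟩ => ?_⟩
      obtain ⟨a, rfl⟩ := Ideal.Quotient.mk_surjective x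
      have h1 : r ^ n * a ∈ Ideal.span {t j} := Ideal.Quotient.eq_zero_iff_mem.1 hn
      rw [hj, Ideal.mem_span_singleton, zero_dvd_iff] at h1
      rw [pow_mul_cancel hr h1, map_zero, smul_zero]
    · exact ⟨k, fun x _ => by rw [← hj, quotient_smul_self]⟩
  choose k hk using hk
  -- The sum serves as a common upper bound for the exponents of the summands.
  refine ⟨∑ j, k j, fun m ⟨n, hn⟩ => ?_⟩
  have h1 := LinearMap.congr_fun h m
  simp only [LinearMap.sum_apply, LinearMap.comp_apply, LinearMap.id_apply] at h1
  rw [← h1, Finset.smul_sum]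
  refine Finset.sum_eq_zero fun j _ => ?_
  have h2 := hk j (i j m) ⟨n, by rw [← map_smul, hn, map_zero]⟩
  obtain ⟨b, hb⟩ := pow_dvd_pow r (Finset.single_le_sum (fun l _ => Nat.zero_le (k l))
    (Finset.mem_univ j))
  rw [hb, mul_comm, mul_smul, ← map_smul (p j), h2, map_zero, smul_zero]

theorem IsCyclicRetract.finitePresentation {M : Type*} [AddCommGroup M] [Module R M]
    (h : IsCyclicRetract r M) : Module.FinitePresentation R M := by
  obtain ⟨ι, _, t, i, p, ht, h⟩ := h
  have (j : ι) : Module.FinitePresentation R (R ⧸ Ideal.span {t j}) :=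
    Module.finitePresentation_of_surjective (Ideal.span {t j}).mkQ (Submodule.mkQ_surjective _)
      (by rw [Submodule.ker_mkQ]; exact ⟨{t j}, by simp⟩)
  classical
  let P : (∀ j, R ⧸ Ideal.span {t j}) →ₗ[R] M := LinearMap.lsum R _ R p
  let I : M →ₗ[R] ∀ j, R ⧸ Ideal.span {t j} := LinearMap.pi i
  have hPI (m) : P (I m) = m := by
    simpa [P, I] using LinearMap.congr_fun h m
  refine Module.finitePresentation_of_surjective P (fun m => ⟨I m, hPI m⟩) ?_
  -- The kernel of a retraction is the image of the complementary projector, hence finitely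
  -- generated.
  have hker : LinearMap.ker P = LinearMap.range (LinearMap.id - I ∘ₗ P) := by
    ext x
    constructor
    · intro hx
      exact ⟨x, by simp [LinearMap.mem_ker.1 hx]⟩
    · rintro ⟨y, rfl⟩
      simp [hPI]
  rw [hker, LinearMap.range_eq_map]
  exact Module.Finite.fg_top.map _

end CyclicRetract

/-! ### Functoriality of the subquotients `r ^ n M / r ^ (n + 1) M` -/

section MuSubquotient

variable {R : Type u} [CommRing R] (r : R) (M N : Type*) [AddCommGroup M] [Module R M]
  [AddCommGroup N] [Module R N] (n : ℕ)

/-- The map `M → r ^ n M / r ^ (n + 1) M` sending `m` to the class of `r ^ n m`. -/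
def muClass : M →ₗ[R] MuSubquotient r M n :=
  Submodule.mkQ _ ∘ₗ (LinearMap.lsmul R M (r ^ n)).codRestrict (powSubmodule r M n)
    fun m => mem_span_singleton_smul_top.2 ⟨m, rfl⟩

theorem muClass_surjective : Function.Surjective (muClass r M n) := by
  intro v
  obtain ⟨⟨m, hm⟩, rfl⟩ := Submodule.mkQ_surjective _ v
  obtain ⟨m', rfl⟩ := mem_span_singleton_smul_top.1 hm
  exact ⟨m', rfl⟩

variable {r M N n}

theorem muClass_eq_zero_iff {m : M} : muClass r M n m = 0 ↔ ∃ m', r ^ (n + 1) • m' = r ^ n • m := by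
  refine mkQ_eq_zero_iff_exists_smul.trans ⟨?_, ?_⟩
  · rintro ⟨⟨y, hy⟩, h⟩
    obtain ⟨m', rfl⟩ := mem_span_singleton_smul_top.1 hy
    exact ⟨m', by rw [pow_succ', mul_smul]; exact congrArg Subtype.val h⟩
  · rintro ⟨m', h⟩
    refine ⟨⟨r ^ n • m', mem_span_singleton_smul_top.2 ⟨m', rfl⟩⟩, Subtype.ext ?_⟩
    rw [pow_succ', mul_smul] at h
    exact h

theorem ker_muClass_le {X : Type*} [AddCommGroup X] [Module R X] {g : M →ₗ[R] X}
    (hg : ∀ m m', r ^ (n + 1) • m' = r ^ n • m → g m = 0) :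
    LinearMap.ker (muClass r M n) ≤ LinearMap.ker g := fun m hm =>
  have ⟨m', h⟩ := muClass_eq_zero_iff.1 hm
  hg m m' h

/-- Linear maps out of `r ^ n M / r ^ (n + 1) M` induced by linear maps out of `M`. -/
def muLift {X : Type*} [AddCommGroup X] [Module R X] [Module (R ⧸ Ideal.span {r}) X]
    [IsScalarTower R (R ⧸ Ideal.span {r}) X] (g : M →ₗ[R] X)
    (hg : ∀ m m', r ^ (n + 1) • m' = r ^ n • m → g m = 0) :
    MuSubquotient r M n →ₗ[R ⧸ Ideal.span {r}] X :=
  LinearMap.extendScalarsOfSurjective Ideal.Quotient.mk_surjective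
    ((LinearMap.ker (muClass r M n)).liftQ g (ker_muClass_le hg) ∘ₗ
      ((muClass r M n).quotKerEquivOfSurjective (muClass_surjective r M n)).symm.toLinearMap)

@[simp]
theorem muLift_muClass {X : Type*} [AddCommGroup X] [Module R X] [Module (R ⧸ Ideal.span {r}) X]
    [IsScalarTower R (R ⧸ Ideal.span {r}) X] (g : M →ₗ[R] X)
    (hg : ∀ m m', r ^ (n + 1) • m' = r ^ n • m → g m = 0) (m : M) :
    muLift g hg (muClass r M n m) = g m := by
  let e := (muClass r M n).quotKerEquivOfSurjective (muClass_surjective r M n)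
  have : e.symm (muClass r M n m) = Submodule.Quotient.mk m := e.symm_apply_eq.2 rfl
  change (LinearMap.ker (muClass r M n)).liftQ g (ker_muClass_le hg) (e.symm (muClass r M n m)) = g m
  rw [this]
  rfl

theorem mu_hom_ext {X : Type*} [AddCommGroup X] [Module (R ⧸ Ideal.span {r}) X]
    {f g : MuSubquotient r M n →ₗ[R ⧸ Ideal.span {r}] X}
    (h : ∀ m, f (muClass r M n m) = g (muClass r M n m)) : f = g := by
  refine LinearMap.ext fun v => ?_
  obtain ⟨m, rfl⟩ := muClass_surjective r M n v
  exact h m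

variable (r n) in
/-- The map induced by a linear map on the subquotients. -/
def muMap (f : M →ₗ[R] N) : MuSubquotient r M n →ₗ[R ⧸ Ideal.span {r}] MuSubquotient r N n :=
  muLift (muClass r N n ∘ₗ f) fun m m' h =>
    muClass_eq_zero_iff.2 ⟨f m', by rw [← map_smul, h, map_smul]⟩

@[simp]
theorem muMap_muClass (f : M →ₗ[R] N) (m : M) :
    muMap r n f (muClass r M n m) = muClass r N n (f m) :=
  muLift_muClass _ _ m

theorem sum_muMap_comp_muMap {ι : Type} [Fintype ι] {X : ι → Type*}
    [∀ j, AddCommGroup (X j)] [∀ j, Module R (X j)] {i : ∀ j, M →ₗ[R] X j} {p : ∀ j, X j →ₗ[R] M}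
    (h : ∑ j, p j ∘ₗ i j = LinearMap.id) :
    ∑ j, muMap r n (p j) ∘ₗ muMap r n (i j) = LinearMap.id := by
  refine mu_hom_ext fun m => ?_
  have h1 := congrArg (muClass r M n) (LinearMap.congr_fun h m)
  simp only [LinearMap.sum_apply, LinearMap.comp_apply, LinearMap.id_apply, map_sum,
    muMap_muClass] at h1 ⊢
  exact h1

/-! ### Subquotients of cyclic modules and of their retracts -/

theorem muClass_eq_zero_of_pow_smul {m : M} (h : r ^ n • m = 0) : muClass r M n m = 0 :=
  muClass_eq_zero_iff.2 ⟨0, by rw [h, smul_zero]⟩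

theorem subsingleton_muSubquotient {t : R} (h : t ∣ r ^ n) :
    Subsingleton (MuSubquotient r (R ⧸ Ideal.span {t}) n) := by
  refine subsingleton_of_forall_eq 0 fun v => ?_
  obtain ⟨m, rfl⟩ := muClass_surjective _ _ _ v
  exact muClass_eq_zero_of_pow_smul (quotient_smul_of_dvd h m)

theorem dvd_of_muClass_quotient_eq_zero (hr : ∀ x : R, r * x = 0 → x = 0) {t : R}
    (h : r ^ (n + 1) ∣ t) {a : R}
    (ha : muClass r (R ⧸ Ideal.span {t}) n (Ideal.Quotient.mk _ a) = 0) : r ∣ a := by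
  obtain ⟨m, hm⟩ := muClass_eq_zero_iff.1 ha
  obtain ⟨b, rfl⟩ := Ideal.Quotient.mk_surjective m
  have h1 : Ideal.Quotient.mk (Ideal.span {t}) (r ^ (n + 1) * b) =
    Ideal.Quotient.mk (Ideal.span {t}) (r ^ n * a) := hm
  obtain ⟨c, hc⟩ := h.trans (Ideal.mem_span_singleton.1 (Ideal.Quotient.eq.1 h1))
  refine ⟨b - c, ?_⟩
  rw [← sub_eq_zero]
  refine pow_mul_cancel (n := n) hr ?_
  linear_combination (-1 : R) * hc

theorem dvd_pow_or_pow_succ_dvd {t : R} (ht : t = 0 ∨ ∃ k : ℕ, t = r ^ k) (n : ℕ) :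
    t ∣ r ^ n ∨ r ^ (n + 1) ∣ t := by
  rcases ht with rfl | ⟨k, rfl⟩
  · exact Or.inr (dvd_zero _)
  · exact (le_or_gt k n).imp (pow_dvd_pow r) (pow_dvd_pow r)

/-- Either `t ∣ r ^ n` and the subquotient vanishes, or `r ^ (n + 1) ∣ t` and the class of `a`
determines, and is determined by, `a` modulo `r`. -/
theorem projective_muSubquotient_quotient (hr : ∀ x : R, r * x = 0 → x = 0) {t : R}
    (ht : t = 0 ∨ ∃ k : ℕ, t = r ^ k) (n : ℕ) :
    Module.Projective (R ⧸ Ideal.span {r}) (MuSubquotient r (R ⧸ Ideal.span {t}) n) := by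
  rcases dvd_pow_or_pow_succ_dvd ht n with h | h
  · have := subsingleton_muSubquotient h
    infer_instance
  · have h1 : Ideal.span {t} ≤ Ideal.span {r} := Ideal.span_singleton_le_span_singleton.2
      ((dvd_pow_self r n.succ_ne_zero).trans h)
    refine Module.Projective.of_split (M := R ⧸ Ideal.span {r})
      (muLift (Submodule.mapQ (Ideal.span {t}) (Ideal.span {r}) LinearMap.id h1)
        fun m m' hm => ?_)
      (LinearMap.toSpanSingleton _ _ (muClass r _ n 1)) (mu_hom_ext fun m => ?_)
    · obtain ⟨a, rfl⟩ := Ideal.Quotient.mk_surjective m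
      exact Ideal.Quotient.eq_zero_iff_mem.2 (Ideal.mem_span_singleton.2
        (dvd_of_muClass_quotient_eq_zero hr h (muClass_eq_zero_iff.2 ⟨m', hm⟩)))
    · obtain ⟨a, rfl⟩ := Ideal.Quotient.mk_surjective m
      rw [LinearMap.comp_apply, muLift_muClass]
      change a • muClass r (R ⧸ Ideal.span {t}) n 1 = _
      rw [← map_smul]
      exact congrArg _ (congrArg (Ideal.Quotient.mk _) (mul_one a))

theorem projective_of_sum_comp_eq_id {A V : Type*} [CommRing A] [AddCommGroup V] [Module A V]
    {ι : Type} [Fintype ι] {X : ι → Type*} [∀ j, AddCommGroup (X j)] [∀ j, Module A (X j)]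
    [∀ j, Module.Projective A (X j)] {i : ∀ j, V →ₗ[A] X j} {p : ∀ j, X j →ₗ[A] V}
    (h : ∑ j, p j ∘ₗ i j = LinearMap.id) : Module.Projective A V := by
  classical
  refine Module.Projective.of_split (M := Π₀ j, X j)
    ((DFinsupp.linearEquivFunOnFintype (R := A)).symm.toLinearMap ∘ₗ LinearMap.pi i)
    (LinearMap.lsum A _ A p ∘ₗ (DFinsupp.linearEquivFunOnFintype (R := A)).toLinearMap) ?_
  refine LinearMap.ext fun v => ?_
  rw [LinearMap.comp_apply, LinearMap.comp_apply, LinearMap.comp_apply, LinearEquiv.coe_coe,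
    LinearEquiv.coe_coe, LinearEquiv.apply_symm_apply]
  simpa using LinearMap.congr_fun h v

theorem IsCyclicRetract.projective_muSubquotient (hr : ∀ x : R, r * x = 0 → x = 0)
    (h : IsCyclicRetract r M) (n : ℕ) :
    Module.Projective (R ⧸ Ideal.span {r}) (MuSubquotient r M n) := by
  obtain ⟨ι, _, t, i, p, ht, h⟩ := h
  have (j : ι) := projective_muSubquotient_quotient hr (ht j) n
  exact projective_of_sum_comp_eq_id (sum_muMap_comp_muMap (r := r) (n := n) h)

theorem finite_muSubquotient [Module.Finite R M] :
    Module.Finite (R ⧸ Ideal.span {r}) (MuSubquotient r M n) :=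
  have : Module.Finite R (MuSubquotient r M n) :=
    Module.Finite.of_surjective _ (muClass_surjective r M n)
  Module.Finite.of_restrictScalars_finite R _ _

/-! ### Subquotients of tensor products -/

variable (r N n) in
/-- The map `b ↦ m ⊗ b` on subquotients. -/
def muTensorLeft (m : M) :
    MuSubquotient r N n →ₗ[R ⧸ Ideal.span {r}] MuSubquotient r (M ⊗[R] N) n :=
  muMap r n (TensorProduct.mk R M N m)

@[simp]
theorem muTensorLeft_muClass (m : M) (b : N) :
    muTensorLeft r N n m (muClass r N n b) = muClass r (M ⊗[R] N) n (m ⊗ₜ b) :=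
  muMap_muClass _ _

variable (r M N n) in
/-- The map `m ↦ (b ↦ m ⊗ b)` on subquotients. -/
def muTensorAux : M →ₗ[R]
    (MuSubquotient r N n →ₗ[R ⧸ Ideal.span {r}] MuSubquotient r (M ⊗[R] N) n) where
  toFun := muTensorLeft r N n
  map_add' m m' := mu_hom_ext fun a => by
    rw [LinearMap.add_apply, muTensorLeft_muClass, muTensorLeft_muClass, muTensorLeft_muClass,
      TensorProduct.add_tmul, map_add]
  map_smul' c m := mu_hom_ext fun a => by
    rw [RingHom.id_apply, LinearMap.smul_apply, muTensorLeft_muClass, muTensorLeft_muClass,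
      ← TensorProduct.smul_tmul', map_smul]

variable (r M N n) in
/-- The comparison map from the tensor product of the subquotients to the subquotient of the
tensor product. -/
def muTensor : MuSubquotient r M n ⊗[R ⧸ Ideal.span {r}] MuSubquotient r N n
    →ₗ[R ⧸ Ideal.span {r}] MuSubquotient r (M ⊗[R] N) n :=
  TensorProduct.lift (muLift (muTensorAux r M N n) fun m m' h => mu_hom_ext fun a =>
    (muTensorLeft_muClass m a).trans (muClass_eq_zero_iff.2 ⟨m' ⊗ₜ a, by
      rw [TensorProduct.smul_tmul', h, ← TensorProduct.smul_tmul']⟩))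

@[simp]
theorem muTensor_tmul (a : M) (b : N) :
    muTensor r M N n (muClass r M n a ⊗ₜ muClass r N n b) = muClass r (M ⊗[R] N) n (a ⊗ₜ b) := by
  rw [muTensor, TensorProduct.lift.tmul, muLift_muClass]
  exact muTensorLeft_muClass a b

theorem muTensor_surjective : Function.Surjective (muTensor r M N n) := by
  intro v
  obtain ⟨x, rfl⟩ := muClass_surjective _ _ _ v
  induction x with
  | zero => exact ⟨0, by simp⟩
  | add x y hx hy =>
    obtain ⟨a, ha⟩ := hx
    obtain ⟨b, hb⟩ := hy
    exact ⟨a + b, by rw [map_add, map_add, ha, hb]⟩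
  | tmul a b => exact ⟨_, muTensor_tmul a b⟩

theorem muTensor_naturality {M' N' : Type*} [AddCommGroup M'] [Module R M'] [AddCommGroup N']
    [Module R N'] (f : M →ₗ[R] M') (g : N →ₗ[R] N')
    (x : MuSubquotient r M n ⊗[R ⧸ Ideal.span {r}] MuSubquotient r N n) :
    muTensor r M' N' n (TensorProduct.map (muMap r n f) (muMap r n g) x) =
      muMap r n (TensorProduct.map f g) (muTensor r M N n x) := by
  induction x with
  | zero => simp
  | add x y hx hy => simp only [map_add, hx, hy]
  | tmul v w =>
    obtain ⟨a, rfl⟩ := muClass_surjective _ _ _ v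
    obtain ⟨b, rfl⟩ := muClass_surjective _ _ _ w
    simp

/-- If neither factor vanishes, the source is generated by `1 ⊗ 1`, which `r` kills. It remains to
see that a multiple `a` of its image vanishes only when `r ∣ a`. -/
theorem muTensor_quotient_injective (hr : ∀ x : R, r * x = 0 → x = 0) {t u : R}
    (ht : t = 0 ∨ ∃ k : ℕ, t = r ^ k) (hu : u = 0 ∨ ∃ k : ℕ, u = r ^ k) :
    Function.Injective (muTensor r (R ⧸ Ideal.span {t}) (R ⧸ Ideal.span {u}) n) := by
  have hsub (h : t ∣ r ^ n ∨ u ∣ r ^ n) : Subsingleton (MuSubquotient r (R ⧸ Ideal.span {t}) n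
      ⊗[R ⧸ Ideal.span {r}] MuSubquotient r (R ⧸ Ideal.span {u}) n) := by
    refine subsingleton_of_forall_eq 0 fun x => ?_
    induction x with
    | zero => rfl
    | add x y hx hy => rw [hx, hy, add_zero]
    | tmul v w =>
      rcases h with h | h
      · have := subsingleton_muSubquotient h
        rw [Subsingleton.elim v 0, TensorProduct.zero_tmul]
      · have := subsingleton_muSubquotient h
        rw [Subsingleton.elim w 0, TensorProduct.tmul_zero]
  rcases dvd_pow_or_pow_succ_dvd ht n with h | h
  · have := hsub (Or.inl h)
    exact Function.injective_of_subsingleton _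
  rcases dvd_pow_or_pow_succ_dvd hu n with h' | h'
  · have := hsub (Or.inr h')
    exact Function.injective_of_subsingleton _
  -- Both `t` and `u` are divisible by `r ^ (n + 1)`, so multiplication maps the tensor product to
  -- `R / r ^ (n + 1)`, whose `n`-th subquotient still detects `a` modulo `r`.
  let q : R ⧸ Ideal.span {r ^ (n + 1)} := 1
  let g : (R ⧸ Ideal.span {t}) ⊗[R] (R ⧸ Ideal.span {u}) →ₗ[R] R ⧸ Ideal.span {r ^ (n + 1)} :=
    TensorProduct.lift (quotientLift (quotientLift q (quotient_smul_of_dvd h' q))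
      (quotient_hom_ext (by
        rw [LinearMap.smul_apply, quotientLift_one]
        exact quotient_smul_of_dvd h q)))
  have hgen (x : MuSubquotient r (R ⧸ Ideal.span {t}) n ⊗[R ⧸ Ideal.span {r}]
      MuSubquotient r (R ⧸ Ideal.span {u}) n) :
      ∃ a : R, x = a • (muClass r (R ⧸ Ideal.span {t}) n 1 ⊗ₜ muClass r (R ⧸ Ideal.span {u}) n 1) := by
    induction x with
    | zero => exact ⟨0, by rw [zero_smul]⟩
    | add x y hx hy =>
      obtain ⟨a, rfl⟩ := hx
      obtain ⟨b, rfl⟩ := hy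
      exact ⟨a + b, by rw [add_smul]⟩
    | tmul v w =>
      obtain ⟨v, rfl⟩ := muClass_surjective _ _ _ v
      obtain ⟨w, rfl⟩ := muClass_surjective _ _ _ w
      obtain ⟨a, rfl⟩ := Ideal.Quotient.mk_surjective v
      obtain ⟨b, rfl⟩ := Ideal.Quotient.mk_surjective w
      have key (s c : R) : muClass r (R ⧸ Ideal.span {s}) n (Ideal.Quotient.mk _ c) =
          c • muClass r (R ⧸ Ideal.span {s}) n 1 := by
        rw [← map_smul]
        exact congrArg _ (congrArg (Ideal.Quotient.mk _) (mul_one c).symm)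
      exact ⟨a * b, by rw [key, key, mul_smul, ← TensorProduct.tmul_smul, TensorProduct.smul_tmul']⟩
  refine (injective_iff_map_eq_zero _).2 fun x hx => ?_
  obtain ⟨a, rfl⟩ := hgen x
  have h1 := congrArg (muMap r n g) hx
  rw [LinearMap.map_smul_of_tower, muTensor_tmul, ← map_smul, muMap_muClass, map_zero,
    map_smul] at h1
  have h2 : g (1 ⊗ₜ 1) = q := by
    rw [TensorProduct.lift.tmul, quotientLift_one, quotientLift_one]
  have h3 : a • q = Ideal.Quotient.mk _ a := congrArg (Ideal.Quotient.mk _) (mul_one a)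
  rw [h2, h3] at h1
  obtain ⟨b, rfl⟩ := dvd_of_muClass_quotient_eq_zero hr dvd_rfl h1
  rw [mul_comm, mul_smul, TensorProduct.smul_tmul', ← map_smul, muClass_eq_zero_iff.2,
    TensorProduct.zero_tmul, smul_zero]
  exact ⟨1, by rw [smul_smul, pow_succ]⟩

/-- By naturality, the cyclic components of a kernel element lie in kernels of the comparison maps
for cyclic modules, hence vanish; the element is recovered from these components. -/
theorem muTensor_injective (hr : ∀ x : R, r * x = 0 → x = 0) (hM : IsCyclicRetract r M)
    (hN : IsCyclicRetract r N) : Function.Injective (muTensor r M N n) := by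
  obtain ⟨ι, _, t, i, p, ht, h⟩ := hM
  obtain ⟨κ, _, u, i', p', hu, h'⟩ := hN
  refine (injective_iff_map_eq_zero _).2 fun x hx => ?_
  have h1 := LinearMap.congr_fun (sum_map_comp_map (sum_muMap_comp_muMap (r := r) (n := n) h)
    (sum_muMap_comp_muMap (r := r) (n := n) h')) x
  rw [LinearMap.id_apply] at h1
  rw [← h1, LinearMap.sum_apply]
  refine Finset.sum_eq_zero fun k _ => ?_
  rw [LinearMap.comp_apply, muTensor_quotient_injective hr (ht k.1) (hu k.2)
    (a₁ := TensorProduct.map (muMap r n (i k.1)) (muMap r n (i' k.2)) x) (a₂ := 0), map_zero]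
  rw [muTensor_naturality, hx, map_zero, map_zero]

/-- The comparison map is an isomorphism, so the rank of the `n`-th subquotient is the product of
the two constant ranks. -/
theorem hasFiniteProjectiveMuDevissage_tensor (hr : ∀ x : R, r * x = 0 → x = 0)
    (hM : IsCyclicRetract r M) (hN : IsCyclicRetract r N)
    (h : HasFiniteProjectiveMuDevissage r M) (h' : HasFiniteProjectiveMuDevissage r N) :
    HasFiniteProjectiveMuDevissage r (M ⊗[R] N) := by
  intro n
  obtain ⟨_, _, d, hd⟩ := h n
  obtain ⟨_, _, d', hd'⟩ := h' n
  let e := LinearEquiv.ofBijective (muTensor r M N n)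
    ⟨muTensor_injective hr hM hN, muTensor_surjective⟩
  refine ⟨Module.Finite.equiv e, Module.Projective.of_equiv e, d * d', fun P => ?_⟩
  rw [← Module.rankAtStalk_eq_of_equiv e, Module.rankAtStalk_tensorProduct, Pi.mul_apply, hd, hd']

end MuSubquotient

/-! ### Base change of modules of homomorphisms -/

section HomBaseChange

variable {R : Type u} [CommRing R] {r : R} (T : Type u) [CommRing T] [Algebra R T]
  (M N : Type*) [AddCommGroup M] [Module R M] [AddCommGroup N] [Module R N]

variable (R) in
/-- The comparison map `T ⊗ Hom(M, N) → Hom(T ⊗ M, T ⊗ N)`. -/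
def homBaseChange : T ⊗[R] (M →ₗ[R] N) →ₗ[T] (T ⊗[R] M →ₗ[T] T ⊗[R] N) :=
  LinearMap.liftBaseChange T (LinearMap.baseChangeHom R T M N)

variable {M N}

@[simp]
theorem homBaseChange_tmul (a : T) (f : M →ₗ[R] N) :
    homBaseChange R T M N (a ⊗ₜ f) = a • f.baseChange T := by
  rw [homBaseChange, LinearMap.liftBaseChange_tmul, LinearMap.baseChangeHom_apply]

theorem homBaseChange_precomp {M' : Type*} [AddCommGroup M'] [Module R M'] (f : M →ₗ[R] M')
    (x : T ⊗[R] (M' →ₗ[R] N)) :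
    homBaseChange R T M N ((LinearMap.lcomp R N f).baseChange T x) =
      homBaseChange R T M' N x ∘ₗ f.baseChange T := by
  induction x with
  | zero => simp
  | add x y hx hy => simp only [map_add, hx, hy, LinearMap.add_comp]
  | tmul a g =>
    rw [LinearMap.baseChange_tmul, homBaseChange_tmul, homBaseChange_tmul, LinearMap.smul_comp,
      ← LinearMap.baseChange_comp]
    rfl

theorem homBaseChange_postcomp {N' : Type*} [AddCommGroup N'] [Module R N'] (f : N →ₗ[R] N')
    (x : T ⊗[R] (M →ₗ[R] N)) :
    homBaseChange R T M N' ((LinearMap.llcomp R M N N' f).baseChange T x) =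
      f.baseChange T ∘ₗ homBaseChange R T M N x := by
  induction x with
  | zero => simp
  | add x y hx hy => simp only [map_add, hx, hy, LinearMap.comp_add]
  | tmul a g =>
    rw [LinearMap.baseChange_tmul, homBaseChange_tmul, homBaseChange_tmul, LinearMap.comp_smul,
      ← LinearMap.baseChange_comp]
    rfl

theorem sum_baseChange_comp_baseChange {ι : Type} [Fintype ι] {X : ι → Type*}
    [∀ j, AddCommGroup (X j)] [∀ j, Module R (X j)] {i : ∀ j, M →ₗ[R] X j} {p : ∀ j, X j →ₗ[R] M}
    (h : ∑ j, p j ∘ₗ i j = LinearMap.id) (x : T ⊗[R] M) :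
    ∑ j, (p j).baseChange T ((i j).baseChange T x) = x := by
  have h1 := congrArg (LinearMap.baseChangeHom R T M M) h
  rw [map_sum] at h1
  have h2 := LinearMap.congr_fun h1 x
  simpa [LinearMap.baseChange_comp, LinearMap.baseChange_id] using h2

/-- The comparison map is natural in `M`: a kernel element has zero components, and a map `g` is the
sum of the `g ∘ p j ∘ i j` (after base change), each of which can be lifted. -/
theorem homBaseChange_bijective_of_sum_left {ι : Type} [Fintype ι] {X : ι → Type*}
    [∀ j, AddCommGroup (X j)] [∀ j, Module R (X j)] {i : ∀ j, M →ₗ[R] X j} {p : ∀ j, X j →ₗ[R] M}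
    (h : ∑ j, p j ∘ₗ i j = LinearMap.id)
    (hb : ∀ j, Function.Bijective (homBaseChange R T (X j) N)) :
    Function.Bijective (homBaseChange R T M N) := by
  have h' : ∑ j, LinearMap.lcomp R N (i j) ∘ₗ LinearMap.lcomp R N (p j) = LinearMap.id := by
    ext f m
    have h1 := congrArg f (LinearMap.congr_fun h m)
    simpa using h1
  refine ⟨(injective_iff_map_eq_zero _).2 fun x hx => ?_, fun g => ?_⟩
  · rw [← sum_baseChange_comp_baseChange T h' x]
    refine Finset.sum_eq_zero fun j _ => ?_
    rw [(hb j).1 (a₁ := (LinearMap.lcomp R N (p j)).baseChange T x) (a₂ := 0), map_zero]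
    rw [homBaseChange_precomp, hx, LinearMap.zero_comp, map_zero]
  · choose y hy using fun j => (hb j).2 (g ∘ₗ (p j).baseChange T)
    refine ⟨∑ j, (LinearMap.lcomp R N (i j)).baseChange T (y j), LinearMap.ext fun x => ?_⟩
    rw [map_sum, LinearMap.sum_apply]
    conv_rhs => rw [← sum_baseChange_comp_baseChange T h x, map_sum]
    refine Finset.sum_congr rfl fun j _ => ?_
    rw [homBaseChange_precomp, hy]
    rfl

theorem homBaseChange_bijective_of_sum_right {ι : Type} [Fintype ι] {X : ι → Type*}
    [∀ j, AddCommGroup (X j)] [∀ j, Module R (X j)] {i : ∀ j, N →ₗ[R] X j} {p : ∀ j, X j →ₗ[R] N}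
    (h : ∑ j, p j ∘ₗ i j = LinearMap.id)
    (hb : ∀ j, Function.Bijective (homBaseChange R T M (X j))) :
    Function.Bijective (homBaseChange R T M N) := by
  have h' : ∑ j, (LinearMap.llcomp R M (X j) N (p j) : (M →ₗ[R] X j) →ₗ[R] (M →ₗ[R] N)) ∘ₗ
      (LinearMap.llcomp R M N (X j) (i j) : (M →ₗ[R] N) →ₗ[R] (M →ₗ[R] X j)) =
      LinearMap.id := by
    ext f m
    have h1 := LinearMap.congr_fun h (f m)
    simpa using h1
  refine ⟨(injective_iff_map_eq_zero _).2 fun x hx => ?_, fun g => ?_⟩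
  · rw [← sum_baseChange_comp_baseChange T h' x]
    refine Finset.sum_eq_zero fun j _ => ?_
    rw [(hb j).1 (a₁ := (LinearMap.llcomp R M N (X j) (i j)).baseChange T x) (a₂ := 0), map_zero]
    rw [homBaseChange_postcomp, hx, LinearMap.comp_zero, map_zero]
  · choose y hy using fun j => (hb j).2 ((i j).baseChange T ∘ₗ g)
    refine ⟨∑ j, (LinearMap.llcomp R M (X j) N (p j)).baseChange T (y j), LinearMap.ext fun x => ?_⟩
    rw [map_sum, LinearMap.sum_apply]
    conv_rhs => rw [← sum_baseChange_comp_baseChange T h (g x)]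
    refine Finset.sum_congr rfl fun j _ => ?_
    rw [homBaseChange_postcomp, hy]
    rfl

/-! ### Base change of Hom between cyclic modules -/

theorem tmul_quotient_eq_zero_iff {u : R} {a : T} :
    a ⊗ₜ[R] (1 : R ⧸ Ideal.span {u}) = 0 ↔ algebraMap R T u ∣ a := by
  constructor
  · intro h
    let g : T ⊗[R] (R ⧸ Ideal.span {u}) →ₗ[R] T ⧸ Ideal.span {algebraMap R T u} :=
      TensorProduct.lift (LinearMap.flip (quotientLift
        ((Ideal.Quotient.mkₐ R (Ideal.span {algebraMap R T u})).toLinearMap) (by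
          ext x
          change Ideal.Quotient.mk _ (u • x) = 0
          rw [Ideal.Quotient.eq_zero_iff_mem, Ideal.mem_span_singleton, Algebra.smul_def]
          exact Dvd.intro _ rfl)))
    have h1 := congrArg g h
    rw [map_zero, TensorProduct.lift.tmul, LinearMap.flip_apply, quotientLift_one] at h1
    exact Ideal.mem_span_singleton.1 (Ideal.Quotient.eq_zero_iff_mem.1 h1)
  · rintro ⟨b, rfl⟩
    rw [← Algebra.smul_def, TensorProduct.smul_tmul, quotient_smul_self, TensorProduct.tmul_zero]

theorem tmul_quotient_mk {u : R} (a : T) (c : R) :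
    a ⊗ₜ[R] (Ideal.Quotient.mk (Ideal.span {u}) c) = (algebraMap R T c * a) ⊗ₜ[R] 1 := by
  rw [← Algebra.smul_def, TensorProduct.smul_tmul]
  exact congrArg (a ⊗ₜ[R] ·) (congrArg (Ideal.Quotient.mk _) (mul_one c).symm)

theorem exists_eq_tmul_one {u : R} (x : T ⊗[R] (R ⧸ Ideal.span {u})) : ∃ a, x = a ⊗ₜ[R] 1 := by
  induction x with
  | zero => exact ⟨0, by rw [TensorProduct.zero_tmul]⟩
  | add x y hx hy =>
    obtain ⟨a, rfl⟩ := hx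
    obtain ⟨b, rfl⟩ := hy
    exact ⟨a + b, by rw [TensorProduct.add_tmul]⟩
  | tmul a y =>
    obtain ⟨c, rfl⟩ := Ideal.Quotient.mk_surjective y
    exact ⟨_, tmul_quotient_mk T a c⟩

/-- The same `c` and `d` compute the colons over `R` and over `T`, because `r` is a nonzerodivisor
in both. Thus `h₀ : 1 ↦ c` generates both sides with annihilator generated by `d`, without flatness
of `T`. -/
theorem homBaseChange_quotient_bijective (hr : ∀ x : R, r * x = 0 → x = 0)
    (hT : ∀ x : T, algebraMap R T r * x = 0 → x = 0) {t u : R}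
    (ht : t = 0 ∨ ∃ k : ℕ, t = r ^ k) (hu : u = 0 ∨ ∃ k : ℕ, u = r ^ k) :
    Function.Bijective (homBaseChange R T (R ⧸ Ideal.span {t}) (R ⧸ Ideal.span {u})) := by
  obtain ⟨c, d, -, htc, hcd, hcol⟩ := exists_colon_generator ht hu
  obtain ⟨h1, -⟩ := hcol R hr
  obtain ⟨h1', h2'⟩ := hcol T hT
  have hmk {a : R} : Ideal.Quotient.mk (Ideal.span {u}) a = 0 ↔ u ∣ a :=
    Ideal.Quotient.eq_zero_iff_mem.trans Ideal.mem_span_singleton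
  have hsm (a b : R) : a • Ideal.Quotient.mk (Ideal.span {u}) b = Ideal.Quotient.mk _ (a * b) :=
    rfl
  let h₀ : (R ⧸ Ideal.span {t}) →ₗ[R] (R ⧸ Ideal.span {u}) :=
    quotientLift (Ideal.Quotient.mk _ c) (by rw [hsm, hmk]; exact htc)
  have hh₀ : h₀ 1 = Ideal.Quotient.mk _ c := quotientLift_one _ _
  have hgen (g : (R ⧸ Ideal.span {t}) →ₗ[R] (R ⧸ Ideal.span {u})) : ∃ y : R, g = y • h₀ := by
    obtain ⟨a, ha⟩ := Ideal.Quotient.mk_surjective (g 1)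
    have h3 : u ∣ t * a := by
      rw [← hmk, ← hsm, ha, ← map_smul, quotient_smul_self, map_zero]
    obtain ⟨y, hy⟩ := h1 a h3
    refine ⟨y, quotient_hom_ext ?_⟩
    rw [LinearMap.smul_apply, hh₀, hsm, ← ha, ← sub_eq_zero, ← map_sub, hmk, mul_comm y]
    exact hy
  have hdh₀ : d • h₀ = 0 := quotient_hom_ext (by
    rw [LinearMap.smul_apply, hh₀, hsm, LinearMap.zero_apply, hmk, mul_comm]; exact hcd)
  have hval (a : T) : homBaseChange R T _ _ (a ⊗ₜ[R] h₀) (1 ⊗ₜ 1) =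
      (algebraMap R T c * a) ⊗ₜ[R] (1 : R ⧸ Ideal.span {u}) := by
    rw [homBaseChange_tmul, LinearMap.smul_apply, LinearMap.baseChange_tmul, hh₀,
      TensorProduct.smul_tmul', smul_eq_mul, mul_one, tmul_quotient_mk]
  refine ⟨(injective_iff_map_eq_zero _).2 fun x hx => ?_, fun g => ?_⟩
  · obtain ⟨a, rfl⟩ : ∃ a : T, x = a ⊗ₜ[R] h₀ := by
      clear hx
      induction x with
      | zero => exact ⟨0, by rw [TensorProduct.zero_tmul]⟩
      | add x y hx hy =>
        obtain ⟨a, rfl⟩ := hx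
        obtain ⟨b, rfl⟩ := hy
        exact ⟨a + b, by rw [TensorProduct.add_tmul]⟩
      | tmul a g =>
        obtain ⟨y, rfl⟩ := hgen g
        exact ⟨y • a, by rw [TensorProduct.smul_tmul]⟩
    have h3 := hval a
    rw [hx, LinearMap.zero_apply, eq_comm, tmul_quotient_eq_zero_iff] at h3
    obtain ⟨b, rfl⟩ := h2' a h3
    rw [← Algebra.smul_def, TensorProduct.smul_tmul, hdh₀, TensorProduct.tmul_zero]
  · obtain ⟨a, ha⟩ := exists_eq_tmul_one T (g (1 ⊗ₜ 1))
    have h3 : algebraMap R T u ∣ algebraMap R T t * a := by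
      rw [← tmul_quotient_eq_zero_iff, ← smul_eq_mul, ← TensorProduct.smul_tmul', ← ha, ← map_smul,
        TensorProduct.smul_tmul', smul_eq_mul, (tmul_quotient_eq_zero_iff T).2 (Dvd.intro _ rfl),
        map_zero]
    obtain ⟨y, hy⟩ := h1' a h3
    have h4 : a ⊗ₜ[R] (1 : R ⧸ Ideal.span {u}) = (algebraMap R T c * y) ⊗ₜ[R] 1 := by
      rw [← sub_eq_zero, ← TensorProduct.sub_tmul, (tmul_quotient_eq_zero_iff T).2 hy]
    refine ⟨y ⊗ₜ h₀, LinearMap.ext fun x => ?_⟩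
    obtain ⟨b, rfl⟩ := exists_eq_tmul_one T x
    have hb : b ⊗ₜ[R] (1 : R ⧸ Ideal.span {t}) = b • (1 ⊗ₜ 1) := by
      rw [TensorProduct.smul_tmul', smul_eq_mul, mul_one]
    rw [hb, map_smul, map_smul, hval, ha, h4]

theorem IsCyclicRetract.homBaseChange_bijective (hr : ∀ x : R, r * x = 0 → x = 0)
    (hT : ∀ x : T, algebraMap R T r * x = 0 → x = 0) (hM : IsCyclicRetract r M)
    (hN : IsCyclicRetract r N) : Function.Bijective (homBaseChange R T M N) := by
  obtain ⟨ι, _, t, i, p, ht, h⟩ := hM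
  obtain ⟨κ, _, u, i', p', hu, h'⟩ := hN
  exact homBaseChange_bijective_of_sum_left T h fun j =>
    homBaseChange_bijective_of_sum_right T h' fun k =>
      homBaseChange_quotient_bijective T hr hT (ht j) (hu k)

end HomBaseChange

/-! ### Modules over rings with `K₀ = ℤ` -/

section Rank

variable {A : Type u} [CommRing A]

/-- The rank at a prime, as a function of the isomorphism class of a finite projective module. -/
def FinProjClass.rank (p : PrimeSpectrum A) : FinProjClass A →+ ℤ where
  toFun := Quotient.lift (fun P : FinProj A => (Module.rankAtStalk (R := A) P.1 p : ℤ))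
    fun P Q ⟨e⟩ => by
      have := P.2.1
      have := P.2.2
      rw [Module.rankAtStalk_eq_of_equiv e]
  map_zero' := by
    change ((Module.rankAtStalk (R := A) PUnit.{u + 1} p : ℕ) : ℤ) = 0
    rw [Module.rankAtStalk_eq_zero_of_subsingleton]
    rfl
  map_add' := by
    rintro ⟨P⟩ ⟨Q⟩
    have := P.2.1
    have := P.2.2
    have := Q.2.1
    have := Q.2.2
    change ((Module.rankAtStalk (R := A) (P.1 × Q.1) p : ℕ) : ℤ) =
      (Module.rankAtStalk (R := A) P.1 p : ℕ) + (Module.rankAtStalk (R := A) Q.1 p : ℕ)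
    rw [Module.rankAtStalk_prod, Pi.add_apply, Nat.cast_add]

theorem FinProjClass.rank_mk (p : PrimeSpectrum A) (P : Type u) [AddCommGroup P] [Module A P]
    [Module.Finite A P] [Module.Projective A P] :
    FinProjClass.rank p (FinProjClass.mk (A := A) P) = Module.rankAtStalk (R := A) P p := rfl

/-- If `K₀(A) = ℤ`, finite projective `A`-modules have constant rank. -/
theorem K0EqInt.isFiniteProjectiveOfConstantRank (h : K0EqInt A) (P : Type u) [AddCommGroup P]
    [Module A P] [Module.Finite A P] [Module.Projective A P] :
    IsFiniteProjectiveOfConstantRank A P := by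
  refine ⟨‹_›, ‹_›, ?_⟩
  -- The class of `P` is `n [A]`; rank at a prime is additive, so it extends to `K₀` and equals `n`
  -- at every prime.
  obtain ⟨n, hn⟩ := h.2 (Algebra.GrothendieckAddGroup.of (FinProjClass.mk (A := A) P))
  have hrank (p : PrimeSpectrum A) : (Module.rankAtStalk (R := A) P p : ℤ) = n := by
    have : Nontrivial A := p.nontrivial
    have hlift (x : FinProjClass A) : Algebra.GrothendieckAddGroup.lift (FinProjClass.rank p)
        (Algebra.GrothendieckAddGroup.of x) = FinProjClass.rank p x :=
      DFunLike.congr_fun (Algebra.GrothendieckAddGroup.lift.symm_apply_apply _) x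
    have h1 := congrArg (Algebra.GrothendieckAddGroup.lift (FinProjClass.rank p)) hn
    simp only [map_zsmul, K0.one, hlift] at h1
    rw [FinProjClass.rank_mk, FinProjClass.rank_mk, Module.rankAtStalk_self] at h1
    simpa using h1.symm
  -- If there is a prime, `n` is a rank and so nonnegative; otherwise there is nothing to check.
  exact ⟨n.toNat, fun p => by have := hrank p; omega⟩

end Rank

/-! ### Étale modules -/

section Etale

variable {R : Type u} [CommRing R]

/-- The inverse of `Twist.val`. -/
def Twist.ofVal (φ : R →+* R) : R →+* Twist φ := RingHom.id R

instance (φ : R →+* R) : RingHomInvPair (Twist.val φ) (Twist.ofVal φ) := ⟨rfl, rfl⟩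

instance (φ : R →+* R) : RingHomInvPair (Twist.ofVal φ) (Twist.val φ) := ⟨rfl, rfl⟩

variable {S : Type w} [Monoid S] [MulSemiringAction S R]

namespace SModule

theorem isEtale_unit : (unit S R).IsEtale where
  finitePresentation := inferInstanceAs (Module.FinitePresentation R R)
  bijective s := by
    let φ := MulSemiringAction.toRingHom S R s
    have h : ∀ x : Twist φ ⊗[R] R,
        (unit S R).linearised s x = Twist.val φ (TensorProduct.rid R (Twist φ) x) := by
      intro x
      induction x with
      | zero => exact map_zero _
      | add x y hx hy =>
        rw [map_add (TensorProduct.rid R (Twist φ)), map_add (Twist.val φ), ← hx, ← hy]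
        exact map_add ((unit S R).linearised s) x y
      | tmul a y =>
        rw [TensorProduct.rid_tmul]
        exact mul_comm (Twist.val φ a) (φ y)
    rw [show ⇑((unit S R).linearised s) = Twist.val φ ∘ TensorProduct.rid R (Twist φ) from
      funext h]
    exact Function.Bijective.comp Function.bijective_id (TensorProduct.rid R (Twist φ)).bijective

/-- The linearisation of an étale module as a semilinear equivalence. -/
def IsEtale.linearEquiv {D : SModule S R} (h : D.IsEtale) (s : S) :
    Twist (MulSemiringAction.toRingHom S R s) ⊗[R] D
      ≃ₛₗ[Twist.val (MulSemiringAction.toRingHom S R s)] D :=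
  LinearEquiv.ofBijective (D.linearised s) (h.bijective s)

theorem IsEtale.linearEquiv_apply {D : SModule S R} (h : D.IsEtale) (s : S)
    (x : Twist (MulSemiringAction.toRingHom S R s) ⊗[R] D) :
    h.linearEquiv s x = D.linearised s x := rfl

theorem linearised_tmul (D : SModule S R) (s : S)
    (a : Twist (MulSemiringAction.toRingHom S R s)) (d : D) :
    D.linearised s (a ⊗ₜ[R] d) = Twist.val _ a • D.φ s d := rfl

/-- Under `φ^*(D₁ ⊗ D₂) ≅ φ^* D₁ ⊗ φ^* D₂`, the linearisation becomes the tensor product of the two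
linearisations. -/
theorem IsEtale.tensor {D₁ D₂ : SModule S R} (h₁ : D₁.IsEtale) (h₂ : D₂.IsEtale)
    (hfp : Module.FinitePresentation R (D₁ ⊗[R] D₂)) : (D₁.tensor D₂).IsEtale where
  finitePresentation := hfp
  bijective s := by
    let φ := MulSemiringAction.toRingHom S R s
    let e : Twist φ ⊗[R] (D₁ ⊗[R] D₂) ≃ₗ[Twist φ] (Twist φ ⊗[R] D₁) ⊗[Twist φ] (Twist φ ⊗[R] D₂) :=
      AlgebraTensorModule.distribBaseChange R (Twist φ) D₁ D₂
    let e' : (Twist φ ⊗[R] D₁) ⊗[Twist φ] (Twist φ ⊗[R] D₂) ≃ₛₗ[Twist.val φ] D₁ ⊗[R] D₂ :=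
      TensorProduct.congr (h₁.linearEquiv s) (h₂.linearEquiv s)
    have h : ∀ x : Twist φ ⊗[R] (D₁ ⊗[R] D₂), (D₁.tensor D₂).linearised s x = e' (e x) := by
      intro x
      induction x with
      | zero => rw [map_zero, map_zero]; exact map_zero _
      | add x y hx hy =>
        rw [map_add, map_add, ← hx, ← hy]
        exact map_add ((D₁.tensor D₂).linearised s) x y
      | tmul a y =>
        induction y with
        | zero =>
          rw [TensorProduct.tmul_zero, map_zero, map_zero]
          exact map_zero _
        | add x y hx hy =>
          rw [TensorProduct.tmul_add, map_add, map_add, ← hx, ← hy]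
          exact map_add ((D₁.tensor D₂).linearised s) _ _
        | tmul x y =>
          rw [AlgebraTensorModule.distribBaseChange_tmul, TensorProduct.congr_tmul,
            h₁.linearEquiv_apply, h₂.linearEquiv_apply, linearised_one_tmul, linearised_tmul]
          rfl
    rw [show ⇑((D₁.tensor D₂).linearised s) = e' ∘ e from funext h]
    exact e'.bijective.comp e.bijective

/-- The linearised action on the internal Hom, with values in linear maps. -/
def linearisedHom {D₁ : SModule S R} (h : D₁.IsEtale) (D₂ : SModule S R) (s : S)
    (x : Twist (MulSemiringAction.toRingHom S R s) ⊗[R] (D₁ →ₗ[R] D₂)) : D₁ →ₗ[R] D₂ :=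
  (D₁.internalHom h D₂).linearised s x

/-- The linearisation of the internal Hom is the comparison map `homBaseChange` conjugated by the
linearisations of `D₁` and `D₂`; this reduces étaleness of the internal Hom to base change. -/
theorem linearisedHom_linearised {D₁ : SModule S R} (h : D₁.IsEtale) (D₂ : SModule S R)
    (s : S) (x : Twist (MulSemiringAction.toRingHom S R s) ⊗[R] (D₁ →ₗ[R] D₂))
    (y : Twist (MulSemiringAction.toRingHom S R s) ⊗[R] D₁) :
    linearisedHom h D₂ s x (D₁.linearised s y) =
      D₂.linearised s (homBaseChange R _ D₁ D₂ x y) := by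
  induction x with
  | zero =>
    rw [map_zero, LinearMap.zero_apply, map_zero]
    exact LinearMap.congr_fun (map_zero ((D₁.internalHom h D₂).linearised s)) _
  | add x x' hx hx' =>
    rw [map_add, LinearMap.add_apply, map_add, ← hx, ← hx']
    exact LinearMap.congr_fun (map_add ((D₁.internalHom h D₂).linearised s) x x') _
  | tmul a f =>
    rw [homBaseChange_tmul, LinearMap.smul_apply, map_smulₛₗ]
    conv_rhs => rw [← h.inv_linearised s y]
    rfl

theorem internalHom_isEtale {D₁ : SModule S R} (h₁ : D₁.IsEtale) {D₂ : SModule S R}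
    (h₂ : D₂.IsEtale) (hfp : Module.FinitePresentation R (D₁ →ₗ[R] D₂))
    (hb : ∀ s : S, Function.Bijective
      (homBaseChange R (Twist (MulSemiringAction.toRingHom S R s)) D₁ D₂)) :
    (D₁.internalHom h₁ D₂).IsEtale where
  finitePresentation := hfp
  bijective s := by
    refine ⟨(injective_iff_map_eq_zero _).2 fun x hx => ?_, fun g => ?_⟩
    · refine (injective_iff_map_eq_zero
          (homBaseChange R (Twist (MulSemiringAction.toRingHom S R s)) D₁ D₂)).1 (hb s).1 x
        (LinearMap.ext fun y => (h₂.bijective s).1 ?_)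
      rw [LinearMap.zero_apply, map_zero]
      exact (linearisedHom_linearised h₁ D₂ s x y).symm.trans (LinearMap.congr_fun hx _)
    · let g' : D₁ →ₗ[R] D₂ := g
      let G : Twist (MulSemiringAction.toRingHom S R s) ⊗[R] D₁
          →ₗ[Twist (MulSemiringAction.toRingHom S R s)]
          Twist (MulSemiringAction.toRingHom S R s) ⊗[R] D₂ :=
        { toFun := fun y => (h₂.linearEquiv s).symm (g' (h₁.linearEquiv s y))
          map_add' := fun x y => by simp only [map_add]
          map_smul' := fun a x => by
            rw [map_smulₛₗ, map_smul, map_smulₛₗ]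
            rfl }
      obtain ⟨x, hx⟩ := (hb s).2 G
      refine ⟨x, LinearMap.ext fun (d : D₁) => ?_⟩
      obtain ⟨y, rfl⟩ := (h₁.bijective s).2 d
      refine (linearisedHom_linearised h₁ D₂ s x y).trans ?_
      rw [hx]
      exact (h₂.linearEquiv s).apply_symm_apply (g' (D₁.linearised s y))

end SModule

/-! ### Unit, tensor products and internal Hom in the subcategory -/

theorem hasFiniteProjectiveMuDevissage_self {r : R} (hr : ∀ x : R, r * x = 0 → x = 0) :
    HasFiniteProjectiveMuDevissage r R := by
  intro n
  refine ⟨finite_muSubquotient, isCyclicRetract_self.projective_muSubquotient hr n, 1,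
    fun p => ?_⟩
  have : Nontrivial (R ⧸ Ideal.span {r}) := p.nontrivial
  have hmk {x : R} : (Ideal.span {r}).mkQ x = 0 ↔ r ∣ x :=
    Ideal.Quotient.eq_zero_iff_mem.trans Ideal.mem_span_singleton
  let f : MuSubquotient r R n →ₗ[R ⧸ Ideal.span {r}] R ⧸ Ideal.span {r} :=
    muLift (Ideal.span {r}).mkQ fun m m' h => hmk.2 ⟨m', (sub_eq_zero.1 (pow_mul_cancel (n := n) hr
      (by simp only [smul_eq_mul] at h; linear_combination -h)))⟩
  have hf : Function.Bijective f := by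
    refine ⟨(injective_iff_map_eq_zero f).2 fun v hv => ?_, fun y => ?_⟩
    · obtain ⟨m, rfl⟩ := muClass_surjective _ _ _ v
      rw [muLift_muClass, hmk] at hv
      obtain ⟨b, rfl⟩ := hv
      exact muClass_eq_zero_iff.2 ⟨b, by simp only [smul_eq_mul]; ring⟩
    · obtain ⟨x, rfl⟩ := Submodule.mkQ_surjective _ y
      exact ⟨muClass r R n x, muLift_muClass _ _ _⟩
  rw [Module.rankAtStalk_eq_of_equiv (LinearEquiv.ofBijective f hf), Module.rankAtStalk_self]
  rfl

theorem IsEtaleDevissage.isCyclicRetract {r : R} (hr : IsDevissageSetup S r) {D : SModule S R}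
    (h : IsEtaleDevissage r D) : IsCyclicRetract r D := by
  have := h.etale.finitePresentation
  exact (h.devissage.hasDiagonalPresentation hr.complete D h.torsion).isCyclicRetract

/-- In the twisted algebra `r` acts as `φ_s(r)`, which divides `r`; so whatever it kills is killed
by `r`. -/
theorem IsDevissageSetup.twist_torsionFree {r : R} (hr : IsDevissageSetup S r) (s : S)
    (x : Twist (MulSemiringAction.toRingHom S R s)) (hx : algebraMap R _ r * x = 0) : x = 0 := by
  obtain ⟨v, hv⟩ : (s • r : R) ∣ r := by
    rw [← Ideal.mem_span_singleton, hr.span_smul]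
    exact Ideal.mem_span_singleton_self r
  have hx' : (s • r : R) * Twist.val _ x = 0 := hx
  refine hr.torsionFree (Twist.val _ x) ?_
  conv_lhs => rw [hv]
  rw [mul_right_comm, hx', zero_mul]

theorem isEtaleDevissage_unit {r : R} (hr : IsDevissageSetup S r) :
    IsEtaleDevissage r (SModule.unit S R) where
  etale := SModule.isEtale_unit
  devissage := hasFiniteProjectiveMuDevissage_self hr.torsionFree
  torsion := isCyclicRetract_self.hasBoundedTorsion hr.torsionFree

theorem IsEtaleDevissage.tensor {r : R} (hr : IsDevissageSetup S r) {D₁ D₂ : SModule S R}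
    (h₁ : IsEtaleDevissage r D₁) (h₂ : IsEtaleDevissage r D₂) :
    IsEtaleDevissage r (D₁.tensor D₂) where
  etale := h₁.etale.tensor h₂.etale
    ((h₁.isCyclicRetract hr).tensor (h₂.isCyclicRetract hr)).finitePresentation
  devissage := hasFiniteProjectiveMuDevissage_tensor hr.torsionFree (h₁.isCyclicRetract hr)
    (h₂.isCyclicRetract hr) h₁.devissage h₂.devissage
  torsion := ((h₁.isCyclicRetract hr).tensor (h₂.isCyclicRetract hr)).hasBoundedTorsion
    hr.torsionFree

/-- All conditions except constancy of the rank come from the cyclic retract structure; `K₀ = ℤ`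
supplies the constant rank. -/
theorem IsEtaleDevissage.internalHom {r : R} (hr : IsDevissageSetup S r)
    (hK : K0EqInt (R ⧸ Ideal.span {r})) {D₁ D₂ : SModule S R} (h₁ : IsEtaleDevissage r D₁)
    (h₂ : IsEtaleDevissage r D₂) : IsEtaleDevissage r (D₁.internalHom h₁.etale D₂) := by
  have hc := (h₁.isCyclicRetract hr).hom hr.torsionFree (h₂.isCyclicRetract hr)
  have hfp := hc.finitePresentation
  refine ⟨SModule.internalHom_isEtale h₁.etale h₂.etale hfp fun s =>
    (h₁.isCyclicRetract hr).homBaseChange_bijective _ hr.torsionFree (hr.twist_torsionFree s)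
      (h₂.isCyclicRetract hr), fun n => ?_, hc.hasBoundedTorsion hr.torsionFree⟩
  have : Module.Finite (R ⧸ Ideal.span {r}) (MuSubquotient r (D₁ →ₗ[R] D₂) n) :=
    finite_muSubquotient
  have := hc.projective_muSubquotient hr.torsionFree n
  exact hK.isFiniteProjectiveOfConstantRank (MuSubquotient r (D₁ →ₗ[R] D₂) n)

end Etale

end Devissage

end

theorem proposition4p8 {S : Type w} {R : Type u} [Monoid S] [CommRing R] [MulSemiringAction S R]
    (r : R) (hr : Devissage.IsDevissageSetup S r) :
    (Devissage.etaleDevissage S r).IsMonoidal ∧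
      (Devissage.K0EqInt (R ⧸ Ideal.span {r}) →
        ∀ (D₁ D₂ : Devissage.SModule S R) (h₁ : Devissage.etaleDevissage S r D₁),
          Devissage.etaleDevissage S r D₂ →
            Devissage.etaleDevissage S r (D₁.internalHom h₁.etale D₂)) := by
  refine ⟨{ prop_unit := Devissage.isEtaleDevissage_unit hr
            prop_tensor := fun _ _ h₁ h₂ => h₁.tensor hr h₂ }, fun hK _ _ h₁ h₂ =>
    h₁.internalHom hr hK h₂⟩
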